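/- Let $\kappa\in\mathbb N$, let $\mathbb T^\kappa=(\mathbb R/2\pi\mathbb Z)^\kappa$ with $\|\sigma\|_{\mathbb T^\kappa}=(\sum_i\sigma_i^2)^{1/2}$ for representatives $\sigma_i\in[-\pi,\pi]$, let $\mathbf x\in\mathbb R^\kappa$ have rationally independent coordinates, and put $\theta_t\sigma=\mathbf x t+\sigma \pmod{2\pi}$ for $t\in\mathbb R$. Let $\ell^2$ be the space of real square-summable sequences indexed by $\mathbb Z$, let $E=\ell^2\times\ell^2\times\ell^2$ with its Hilbert norm, and equip $E\times\mathbb T^\kappa$ with the metric given by $(\|\varphi\|^2+\|\sigma\|_{\mathbb T^\kappa}^2)^{1/2}$. For subsets $X,Y$ of a metric space let $\mathrm d_H(X,Y)=\sup_{x\in X}d(x,Y)$. Let $d_1,d_2,d_3,k,\alpha,\beta,\lambda>0$ and consider, for $m\in\mathbb Z$ and $t>0$, the discrete Gray–Scott system $$\begin{aligned} \dot u_m&=-d_1(Au)_m-(\lambda+k)u_m+u_m^2v_m-\alpha u_m^3+\beta z_m+b_{1m}f_{1m}(\theta_t\sigma),\\ \dot v_m&=-d_2(Av)_m+\lambda(a_m-v_m)-u_m^2v_m+\alpha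 u_m^3+b_{2m}f_{2m}(\theta_t\sigma),\\ \dot z_m&=-d_3(Az)_m+ku_m-(\lambda+\beta)z_m+b_{3m}f_{3m}(\theta_t\sigma), \end{aligned}$$ where $(Au)_m=2u_m-u_{m+1}-u_{m-1}$, with initial value $(u,v,z)(0)=\varphi_0\in E$ and symbol $\sigma\in\mathbb T^\kappa$. Assume: (H1) $a=(a_m)_m\in\ell^2$, $b_i=(b_{im})_m\in\ell^2$ for $i=1,2,3$, and $2\beta<k<\min\{\frac{3\lambda}{2\mu-1},\beta+\lambda\}$, where $\mu=k/\beta$; (H2) $f_{im}:\mathbb T^\kappa\to\mathbb R$ satisfies $f_{im}(0)=0$ for all $i,m$, and there are $c_1,c_2,c_3>0$ with $|f_{im}(\sigma)-f_{im}(\sigma')|\le c_i\|\sigma-\sigma'\|_{\mathbb T^\kappa}$ for all $m\in\mathbb Z$, $\sigma,\sigma'\in\mathbb T^\kappa$, $i=1,2,3$. Then for all $\varphi_0\in E$ and $\sigma\in\mathbb T^\kappa$ the system has a unique solution $[0,\infty)\to E$ (continuous on $[0,\infty)$ and differentiable on $(0,\infty)$ in the norm of $E$); write $U_\sigma(t,0)\varphi_0$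 for its value at time $t\ge0$. The family $\{U_\sigma(t,0)\}_{t\ge0}$, $\sigma\in\mathbb T^\kappa$, has a pullback attractor $\{A(\sigma)\}_{\sigma\in\mathbb T^\kappa}$ (that is: every $A(\sigma)$ is compact; $U_\sigma(t,0)A(\sigma)=A(\theta_t\sigma)$ for $t\ge0$; $\mathrm d_H(U_{\theta_{-t}\sigma}(t,0)B,A(\sigma))\to0$ as $t\to+\infty$ for every $\sigma$ and every bounded $B\subset E$; and $A$ is minimal among the families of closed sets with the last property), and $\mathcal A=\bigcup_{\sigma}A(\sigma)\times\{\sigma\}$ is the global attractor of the skew-product flow $\Psi(t)(\varphi,\sigma)=(U_\sigma(t,0)\varphi,\theta_t\sigma)$ on $E\times\mathbb T^\kappa$ (compact, $\Psi(t)\mathcal A=\mathcal A$ for $t\ge0$, attracting every bounded set). Let $\mathcal N_\varepsilon(\sigma)=\{\varphi\in E:\ d((\varphi,\sigma),\mathcal A)<\varepsilon\}$ be the $\sigma$-section of the $\varepsilon$-neighborhood of $\mathcal A$ in $E\times\mathbb T^\kappa$. For every $\varepsilon>0$ there is a family $\{\mathcal A_\varepsilon(\sigma)\}_{\sigma\in\mathbb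 T^\kappa}$ of subsets of $E$ such that 1. $A(\sigma)\subset\mathcal A_\varepsilon(\sigma)\subset\mathcal N_\varepsilon(\sigma)$ for all $\sigma\in\mathbb T^\kappa$; 2. it is forward invariant: $U_\sigma(t,0)\mathcal A_\varepsilon(\sigma)\subset\mathcal A_\varepsilon(\theta_t\sigma)$ for all $t\ge0$ and $\sigma\in\mathbb T^\kappa$; 3. it uniformly forward attracts every bounded set $B\subset E$: $\displaystyle\lim_{t\to+\infty}\sup_{\sigma\in\mathbb T^\kappa}\mathrm d_H\big(U_\sigma(t,0)B,\mathcal A_\varepsilon(\theta_t\sigma)\big)=0.$ -/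

import Mathlib

open Filter Topology
open scoped ENNReal Real

/-- The Hilbert space `ℓ²` of real square-summable sequences indexed by `ℤ`. -/
abbrev EllTwo : Type := lp (fun _ : ℤ => ℝ) 2

/-- The phase space `E = ℓ² × ℓ² × ℓ²` with its Hilbert (Euclidean product) norm; the components
`0, 1, 2` of `φ : PhaseSpace` are `u, v, z`. -/
abbrev PhaseSpace : Type := PiLp 2 (fun _ : Fin 3 => EllTwo)

/-- The `κ`-dimensional torus `(ℝ / 2πℤ)^κ`. Its norm is the Euclidean norm of the representative
with coordinates in `[-π, π]`. -/
abbrev Torus (κ : ℕ) : Type := PiLp 2 (fun _ : Fin κ => AddCircle (2 * π))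

/-- The extended space `E × 𝕋^κ` with the norm `(‖φ‖² + ‖σ‖²)^{1/2}`. -/
abbrev ExtendedSpace (κ : ℕ) : Type := WithLp 2 (PhaseSpace × Torus κ)

/-- The data of the lattice system. The index `i : Fin 3` of `b` and `f` refers to the
`u`-, `v`- and `z`-equation. -/
structure GrayScott (κ : ℕ) where
  (d₁ d₂ d₃ k α β lam : ℝ)
  a : EllTwo
  b : Fin 3 → EllTwo
  f : Fin 3 → ℤ → Torus κ → ℝ
  /-- the frequency vector of the quasi-periodic forcing -/
  x : Fin κ → ℝ

/-- `(Au)_m = 2 u_m - u_{m+1} - u_{m-1}`. -/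
def latticeA (u : ℤ → ℝ) (m : ℤ) : ℝ := 2 * u m - u (m + 1) - u (m - 1)

/-- The semidistance `d_H(A, B) = sup_{x ∈ A} d(x, B)`, as an extended nonnegative number
(so `d(x, ∅) = ∞`). -/
noncomputable def semidist {X : Type*} [PseudoEMetricSpace X] (A B : Set X) : ℝ≥0∞ :=
  ⨆ x ∈ A, Metric.infEDist x B

/-- `S` is the global attractor of the family of maps `Ψ t`, `t ≥ 0`: it is compact, invariant, and
attracts every bounded set. -/
structure IsGlobalAttractor {X : Type*} [MetricSpace X] (Ψ : ℝ → X → X) (S : Set X) : Prop where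
  isCompact : IsCompact S
  invariant : ∀ t, 0 ≤ t → Ψ t '' S = S
  attracts : ∀ B : Set X, Bornology.IsBounded B →
    Tendsto (fun t : ℝ => semidist (Ψ t '' B) S) atTop (𝓝 0)

namespace GrayScott

variable {κ : ℕ} (P : GrayScott κ)

/-- The parameters `d₁, d₂, d₃, k, α, β, λ` are positive and the frequencies are rationally
independent. -/
structure Standing : Prop where
  d₁_pos : 0 < P.d₁
  d₂_pos : 0 < P.d₂
  d₃_pos : 0 < P.d₃
  k_pos : 0 < P.k
  α_pos : 0 < P.α
  β_pos : 0 < P.β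
  lam_pos : 0 < P.lam
  indep : LinearIndependent ℚ P.x

/-- `2β < k < min {3λ / (2μ - 1), β + λ}` with `μ = k / β`
(the sequences `a`, `b i` are square-summable by their type). -/
def H1 : Prop :=
  2 * P.β < P.k ∧ P.k < min (3 * P.lam / (2 * (P.k / P.β) - 1)) (P.β + P.lam)

/-- The `f i m` vanish at `0` and are Lipschitz on the torus with a constant `c i > 0`
independent of `m`. -/
def H2 : Prop :=
  (∀ i m, P.f i m 0 = 0) ∧
  ∃ c : Fin 3 → ℝ, (∀ i, 0 < c i) ∧
    ∀ i m (σ₁ σ₂ : Torus κ), |P.f i m σ₁ - P.f i m σ₂| ≤ c i * ‖σ₁ - σ₂‖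

/-- The translation `θ_t σ = x t + σ` on the torus. -/
noncomputable def θ (t : ℝ) (σ : Torus κ) : Torus κ :=
  WithLp.toLp 2 (fun i => ((P.x i * t : ℝ) : AddCircle (2 * π)) + σ i)

/-- The right-hand sides of the `u`-, `v`- and `z`-equation at the lattice site `m`, in the state
`(u, v, z)`, when the forcing symbol is `σ`. -/
noncomputable def rhs (σ : Torus κ) (u v z : ℤ → ℝ) (m : ℤ) : Fin 3 → ℝ :=
  ![-P.d₁ * latticeA u m - (P.lam + P.k) * u m + u m ^ 2 * v m - P.α * u m ^ 3 + P.β * z m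
      + P.b 0 m * P.f 0 m σ,
    -P.d₂ * latticeA v m + P.lam * (P.a m - v m) - u m ^ 2 * v m + P.α * u m ^ 3
      + P.b 1 m * P.f 1 m σ,
    -P.d₃ * latticeA z m + P.k * u m - (P.lam + P.β) * z m
      + P.b 2 m * P.f 2 m σ]

/-- `φ` is a solution on `[0, ∞)` with initial value `φ₀` at time `0` and initial symbol `σ`:
it is continuous on `[0, ∞)` in the norm of `E`, and for every `t > 0` it is differentiable in the
norm of `E` and satisfies the equations with the forcing `f (θ_t σ)`. -/
structure IsSolution (σ : Torus κ) (φ₀ : PhaseSpace) (φ : ℝ → PhaseSpace) : Prop where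
  continuousOn : ContinuousOn φ (Set.Ici 0)
  initial : φ 0 = φ₀
  equation : ∀ t, 0 < t → ∃ φ' : PhaseSpace, HasDerivAt φ φ' t ∧
    ∀ i m, φ' i m = P.rhs (P.θ t σ) (φ t 0) (φ t 1) (φ t 2) m i

/-- `U t σ = U_σ(t, 0)`, `t ≥ 0`, is the family of solution operators of the system: the initial
value problem is uniquely solvable, and `t ↦ U t σ φ₀` is the solution. -/
structure IsSolutionFamily (U : ℝ → Torus κ → PhaseSpace → PhaseSpace) : Prop where
  isSolution : ∀ σ φ₀, P.IsSolution σ φ₀ (fun t => U t σ φ₀)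
  unique : ∀ σ φ₀ ψ, P.IsSolution σ φ₀ ψ → ∀ t, 0 ≤ t → ψ t = U t σ φ₀

/-- The skew-product flow `Ψ(t)(φ, σ) = (U_σ(t, 0) φ, θ_t σ)`. -/
noncomputable def skewProduct (U : ℝ → Torus κ → PhaseSpace → PhaseSpace) (t : ℝ)
    (p : ExtendedSpace κ) : ExtendedSpace κ :=
  WithLp.toLp 2 (U t p.snd p.fst, P.θ t p.snd)

/-- `{A(σ)}` is the pullback attractor of `{U_σ(t, 0)}`: compact, invariant, pullback attracting
every bounded set, and minimal among the closed families with the last property. Note that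
`U_σ(0, -t) = U_{θ_{-t} σ}(t, 0)`. -/
structure IsPullbackAttractor (U : ℝ → Torus κ → PhaseSpace → PhaseSpace)
    (A : Torus κ → Set PhaseSpace) : Prop where
  isCompact : ∀ σ, IsCompact (A σ)
  invariant : ∀ σ t, 0 ≤ t → U t σ '' A σ = A (P.θ t σ)
  attracts : ∀ σ, ∀ B : Set PhaseSpace, Bornology.IsBounded B →
    Tendsto (fun t : ℝ => semidist (U t (P.θ (-t) σ) '' B) (A σ)) atTop (𝓝 0)
  minimal : ∀ C : Torus κ → Set PhaseSpace, (∀ σ, IsClosed (C σ)) →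
    (∀ σ, ∀ B : Set PhaseSpace, Bornology.IsBounded B →
      Tendsto (fun t : ℝ => semidist (U t (P.θ (-t) σ) '' B) (C σ)) atTop (𝓝 0)) →
    ∀ σ, A σ ⊆ C σ

end GrayScott

/-- The union `⋃_σ A(σ) × {σ}`. -/
def bundle {κ : ℕ} (A : Torus κ → Set PhaseSpace) : Set (ExtendedSpace κ) :=
  {p | p.fst ∈ A p.snd}

/-- `𝒩_ε(σ)`: the `σ`-section of the `ε`-neighbourhood of `⋃_σ A(σ) × {σ}` in `E × 𝕋^κ`. -/
def nbhdSection {κ : ℕ} (A : Torus κ → Set PhaseSpace) (ε : ℝ) (σ : Torus κ) : Set PhaseSpace :=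
  {φ | (WithLp.toLp 2 (φ, σ) : ExtendedSpace κ) ∈ Metric.thickening ε (bundle A)}

/-! The cubic terms are dissipative in the energy `∑ₘ α uₘ² + vₘ² + (αβ/k) zₘ²`. With these weights
they contribute `-2 uₘ² (vₘ - α uₘ)²`, and the linear exchange between `u` and `z` completes to `-2
(α/k) (k uₘ - β zₘ)²`. Linear damping of rate `2λ` is left; half of it pays for `a` and the forcing,
and diffusion only helps. Hence the energy decays at rate `λ` down to a level independent of the
symbol. This gives global existence and an absorbing ball uniform in `σ` (`reaction_energy_le`,
`energy_le`, `norm_sq_le_exp`).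

Closed balls of `E` are not compact, so tails must be controlled. The same computation with site
weights `min (|m|/n) 1` changes only the diffusion term, where summation by parts leaves second
differences of the weight, at most `2/n`. The weighted source is small for large `n` by dominated
convergence, so after a long time orbits are uniformly close to finitely supported sequences
(`exists_tail_le`). As the torus is compact, the skew-product flow is asymptotically compact and its
limit points form a global attractor. Each `θ_t` is a bijection of the torus, so the sections of
this attractor form the pullback attractor.

For the last claim, choose `T` such that from time `T` on the flow maps a large ball times the torus
into the `ε`-neighbourhood of the attractor. The set over `σ` consists of all states over `σ`
reached from that ball after a time `t ≥ T`. Running longer keeps this form, whence forward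
invariance; any bounded set enters the ball and `T` later lies inside the family, so its distance is
eventually zero, uniformly in `σ`. -/

/-! ### Grönwall's inequality -/

section Gronwall

/-- Grönwall's inequality, with derivatives required in the interior only. -/
theorem le_exp_of_deriv_le {g g' : ℝ → ℝ} {T c K : ℝ}
    (hg : ContinuousOn g (Set.Icc 0 T))
    (hd : ∀ t ∈ Set.Ioo 0 T, HasDerivAt g (g' t) t)
    (hle : ∀ t ∈ Set.Ioo 0 T, g' t ≤ c * (K - g t)) {t : ℝ} (ht : t ∈ Set.Icc 0 T) :
    g t ≤ K + Real.exp (-(c * t)) * (g 0 - K) := by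
  -- Integrating factor; no sign of `c` is needed, and a negative `c` is used later for exponential
  -- growth.
  have hanti : AntitoneOn (fun s => Real.exp (c * s) * (g s - K)) (Set.Icc 0 T) := by
    refine antitoneOn_of_deriv_nonpos (convex_Icc 0 T) ?_ ?_ ?_
    · exact (by fun_prop : Continuous fun s : ℝ => Real.exp (c * s)).continuousOn.mul
        (hg.sub continuousOn_const)
    all_goals
      intro s hs
      rw [interior_Icc] at hs
      have h : HasDerivAt (fun s => Real.exp (c * s) * (g s - K)) _ s :=
        (((hasDerivAt_id s).const_mul c).exp).mul ((hd s hs).sub_const K)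
    · exact h.differentiableAt.differentiableWithinAt
    · rw [HasDerivAt.deriv h]
      have h1 := hle s hs
      have h2 := Real.exp_pos (c * s)
      simp only [id, mul_one]
      nlinarith
  have h := hanti ⟨le_rfl, ht.1.trans ht.2⟩ ht ht.1
  simp only [mul_zero, Real.exp_zero, one_mul] at h
  rw [Real.exp_neg]
  have h2 := Real.exp_pos (c * t)
  have h3 : g t - K ≤ (Real.exp (c * t))⁻¹ * (g 0 - K) := by
    rw [inv_mul_eq_div, le_div_iff₀ h2]; linarith
  linarith

end Gronwall

/-! ### Global attractors of asymptotically compact semigroups -/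

section GlobalAttractor

variable {X : Type*} [MetricSpace X]

theorem tendsto_semidist_of_subseq {Ψ : ℝ → X → X} {B S : Set X}
    (h : ∀ (t : ℕ → ℝ) (x : ℕ → X), Tendsto t atTop atTop → (∀ n, x n ∈ B) →
      ∃ y ∈ S, ∃ ns : ℕ → ℕ, StrictMono ns ∧
        Tendsto (fun n => Ψ (t (ns n)) (x (ns n))) atTop (𝓝 y)) :
    Tendsto (fun t : ℝ => semidist (Ψ t '' B) S) atTop (𝓝 0) := by
  rw [ENNReal.tendsto_nhds_zero]
  intro ε hε
  by_contra hcon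
  rw [Filter.not_eventually] at hcon
  have key : ∀ n : ℕ, ∃ t : ℝ, ∃ x, (n : ℝ) ≤ t ∧ x ∈ B ∧ ε < Metric.infEDist (Ψ t x) S := by
    intro n
    obtain ⟨t, htn, ht⟩ := (frequently_atTop.1 hcon) (n : ℝ)
    rw [not_le, semidist, lt_iSup_iff] at ht
    obtain ⟨_, ht⟩ := ht
    rw [lt_iSup_iff] at ht
    obtain ⟨⟨x, hx, rfl⟩, ht⟩ := ht
    exact ⟨t, x, htn, hx, ht⟩
  choose t x htn hx hlt using key
  obtain ⟨y, hy, ns, hns, hlim⟩ :=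
    h t x (tendsto_atTop_mono htn tendsto_natCast_atTop_atTop) hx
  have h1 : Tendsto (fun n => edist (Ψ (t (ns n)) (x (ns n))) y) atTop (𝓝 0) := by
    have := hlim.edist (tendsto_const_nhds (x := y))
    simpa using this
  obtain ⟨n, hn⟩ := ((ENNReal.tendsto_nhds_zero.1 h1) ε hε).exists
  exact absurd ((Metric.infEDist_le_edist_of_mem hy).trans hn) (not_le.2 (hlt _))

/-- A family of maps is asymptotically compact on `B` if all sequences `Ψ (t n) (x n)` with
`t n → ∞` and `x n ∈ B` have convergent subsequences. -/
def AsymptoticallyCompactOn (Ψ : ℝ → X → X) (B : Set X) : Prop :=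
  ∀ (t : ℕ → ℝ) (x : ℕ → X), Tendsto t atTop atTop → (∀ n, x n ∈ B) →
    ∃ y, ∃ ns : ℕ → ℕ, StrictMono ns ∧
      Tendsto (fun n => Ψ (t (ns n)) (x (ns n))) atTop (𝓝 y)

/-- The limit points of the sequences `Ψ (t n) (x n)` with `t n → ∞` and `x n ∈ B`. -/
def limitPoints (Ψ : ℝ → X → X) (B : Set X) : Set X :=
  {y | ∃ (t : ℕ → ℝ) (x : ℕ → X), Tendsto t atTop atTop ∧ (∀ n, x n ∈ B) ∧
    Tendsto (fun n => Ψ (t n) (x n)) atTop (𝓝 y)}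

theorem AsymptoticallyCompactOn.exists_mem_limitPoints {Ψ : ℝ → X → X} {B : Set X}
    (h : AsymptoticallyCompactOn Ψ B) {t : ℕ → ℝ} {x : ℕ → X} (ht : Tendsto t atTop atTop)
    (hx : ∀ n, x n ∈ B) :
    ∃ y ∈ limitPoints Ψ B, ∃ ns : ℕ → ℕ, StrictMono ns ∧
      Tendsto (fun n => Ψ (t (ns n)) (x (ns n))) atTop (𝓝 y) := by
  obtain ⟨y, ns, hns, hy⟩ := h t x ht hx
  exact ⟨y, ⟨t ∘ ns, x ∘ ns, ht.comp hns.tendsto_atTop, fun n => hx _, hy⟩, ns, hns, hy⟩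

theorem AsymptoticallyCompactOn.isCompact_limitPoints {Ψ : ℝ → X → X} {B : Set X}
    (h : AsymptoticallyCompactOn Ψ B) : IsCompact (limitPoints Ψ B) := by
  apply IsSeqCompact.isCompact
  intro y hy
  have key : ∀ n : ℕ, ∃ t : ℝ, ∃ x, (n : ℝ) ≤ t ∧ x ∈ B ∧ dist (Ψ t x) (y n) < 1 / (n + 1) := by
    intro n
    obtain ⟨t, x, ht, hx, hlim⟩ := hy n
    have h1 := (Metric.tendsto_nhds.1 hlim) (1 / (n + 1)) (by positivity)
    obtain ⟨m, hm1, hm2⟩ := (h1.and (ht.eventually_ge_atTop (n : ℝ))).exists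
    exact ⟨t m, x m, hm2, hx m, hm1⟩
  choose t x htn hx hd using key
  obtain ⟨z, hz, ns, hns, hlim⟩ := h.exists_mem_limitPoints
    (tendsto_atTop_mono htn tendsto_natCast_atTop_atTop) hx
  refine ⟨z, hz, ns, hns, ?_⟩
  have h0 : Tendsto (fun n => dist (Ψ (t n) (x n)) (y n)) atTop (𝓝 0) :=
    squeeze_zero (fun _ => dist_nonneg) (fun n => (hd n).le)
      tendsto_one_div_add_atTop_nhds_zero_nat
  exact (tendsto_iff_of_dist (h0.comp hns.tendsto_atTop)).1 hlim

/-- A continuous semigroup with a bounded absorbing set on which it is asymptotically compact has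
a global attractor. -/
theorem isGlobalAttractor_limitPoints {Ψ : ℝ → X → X} {B : Set X}
    (hadd : ∀ s t x, 0 ≤ s → 0 ≤ t → Ψ (s + t) x = Ψ s (Ψ t x))
    (hcont : ∀ t, 0 ≤ t → Continuous (Ψ t))
    (habs : ∀ D : Set X, Bornology.IsBounded D → ∃ T, 0 ≤ T ∧ ∀ t, T ≤ t → Ψ t '' D ⊆ B)
    (hac : AsymptoticallyCompactOn Ψ B) : IsGlobalAttractor Ψ (limitPoints Ψ B) := by
  refine ⟨hac.isCompact_limitPoints, fun s hs => Set.Subset.antisymm ?_ ?_, fun D hD => ?_⟩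
  · rintro _ ⟨y, ⟨t, x, ht, hx, hlim⟩, rfl⟩
    -- The semigroup law holds for nonnegative times only, so the finitely many terms with `t n < 0`
    -- are dropped.
    obtain ⟨N, hN⟩ := (ht.eventually_ge_atTop 0).exists_forall_of_atTop
    refine ⟨fun n => s + t (n + N), fun n => x (n + N), ?_, fun n => hx _, ?_⟩
    · exact tendsto_atTop_add_const_left _ _ (ht.comp (tendsto_add_atTop_nat N))
    · have h1 := ((hcont s hs).tendsto y).comp (hlim.comp (tendsto_add_atTop_nat N))
      refine h1.congr fun n => ?_
      simp only [Function.comp]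
      rw [hadd _ _ _ hs (hN _ (by omega))]
  · rintro y ⟨t, x, ht, hx, hlim⟩
    -- A preimage of `y` under `Ψ s` arises as a limit point of the same orbits stopped `s` earlier.
    have ht' : Tendsto (fun n => t n - s) atTop atTop := tendsto_atTop_add_const_right _ _ ht
    obtain ⟨z, hz, ns, hns, hz'⟩ := hac.exists_mem_limitPoints ht' hx
    refine ⟨z, hz, ?_⟩
    refine tendsto_nhds_unique ?_ (hlim.comp hns.tendsto_atTop)
    refine (((hcont s hs).tendsto z).comp hz').congr' ?_
    filter_upwards [(ht'.comp hns.tendsto_atTop).eventually_ge_atTop 0] with n hn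
    simp only [Function.comp] at hn ⊢
    rw [← hadd _ _ _ hs hn, add_sub_cancel]
  · apply tendsto_semidist_of_subseq
    intro t x ht hx
    -- Orbits from `D` are restarted at time `T`, when they are already in `B`.
    obtain ⟨T, hT, hTD⟩ := habs D hD
    obtain ⟨z, hz, ns, hns, hz'⟩ := hac.exists_mem_limitPoints
      (t := fun n => t n - T) (x := fun n => Ψ T (x n))
      (tendsto_atTop_add_const_right _ _ ht) (fun n => hTD T le_rfl ⟨x n, hx n, rfl⟩)
    refine ⟨z, hz, ns, hns, hz'.congr' ?_⟩
    filter_upwards [(ht.comp hns.tendsto_atTop).eventually_ge_atTop T] with n hn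
    simp only [Function.comp] at hn
    rw [← hadd _ _ _ (by linarith) hT, sub_add_cancel]

/-- In a complete space a family of maps is asymptotically compact on `B` if its orbits starting
in `B` are eventually covered by finitely many balls of any given radius. -/
theorem asymptoticallyCompactOn_of_cover [CompleteSpace X] {Ψ : ℝ → X → X} {B : Set X}
    (h : ∀ ε > 0, ∃ T : ℝ, ∃ F : Set X, F.Finite ∧
      ∀ t, T ≤ t → ∀ x ∈ B, ∃ y ∈ F, dist (Ψ t x) y < ε) : AsymptoticallyCompactOn Ψ B := by
  intro t x ht hx
  have htb : TotallyBounded (Set.range fun n => Ψ (t n) (x n)) := by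
    rw [Metric.totallyBounded_iff]
    intro ε hε
    obtain ⟨T, F, hF, hcov⟩ := h ε hε
    obtain ⟨N, hN⟩ := (ht.eventually_ge_atTop T).exists_forall_of_atTop
    refine ⟨F ∪ (fun n => Ψ (t n) (x n)) '' Set.Iio N, hF.union ((Set.finite_Iio N).image _), ?_⟩
    rintro _ ⟨n, rfl⟩
    rw [Set.mem_iUnion₂]
    rcases lt_or_ge n N with hn | hn
    · exact ⟨_, Or.inr ⟨n, hn, rfl⟩, Metric.mem_ball_self hε⟩
    · obtain ⟨y, hy, hd⟩ := hcov _ (hN n hn) _ (hx n)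
      exact ⟨y, Or.inl hy, hd⟩
  have hc : IsCompact (closure (Set.range fun n => Ψ (t n) (x n))) :=
    htb.closure.isCompact_of_isClosed isClosed_closure
  obtain ⟨y, -, ns, hns, hy⟩ := hc.tendsto_subseq (x := fun n => Ψ (t n) (x n))
    (fun n => subset_closure ⟨n, rfl⟩)
  exact ⟨y, ns, hns, hy⟩

end GlobalAttractor

/-! ### Global solutions of ordinary differential equations with an energy bound -/

section GlobalExistence

variable {H : Type*} [NormedAddCommGroup H]

/-- A cut-off function, equal to `1` on the ball of radius `R` and to `0` off the ball of radius
`R + 1`. -/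
noncomputable def ballCutoff (R : ℝ) (x : H) : ℝ := max 0 (min 1 (R + 1 - ‖x‖))

theorem ballCutoff_nonneg (R : ℝ) (x : H) : 0 ≤ ballCutoff R x := le_max_left _ _

theorem ballCutoff_le_one (R : ℝ) (x : H) : ballCutoff R x ≤ 1 :=
  max_le zero_le_one (min_le_left _ _)

theorem ballCutoff_eq_one {R : ℝ} {x : H} (h : ‖x‖ ≤ R) : ballCutoff R x = 1 := by
  rw [ballCutoff, min_eq_left (by linarith), max_eq_right zero_le_one]

theorem ballCutoff_eq_zero {R : ℝ} {x : H} (h : R + 1 ≤ ‖x‖) : ballCutoff R x = 0 :=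
  max_eq_left ((min_le_right _ _).trans (by linarith))

theorem abs_ballCutoff_sub_le (R : ℝ) (x y : H) :
    |ballCutoff R x - ballCutoff R y| ≤ ‖x - y‖ := by
  refine (abs_max_sub_max_le_max _ _ _ _).trans (max_le (by simp) ?_)
  refine (abs_min_sub_min_le_max _ _ _ _).trans (max_le (by simp) ?_)
  rw [show R + 1 - ‖x‖ - (R + 1 - ‖y‖) = ‖y‖ - ‖x‖ by ring, norm_sub_rev]
  exact abs_norm_sub_norm_le y x

variable [InnerProductSpace ℝ H]

/-- Product rule for Lipschitz constants. Nothing is known about `F` off the ball, but there the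
cut-off vanishes. If only one point is outside, the cut-off at the other is at most the distance of
the two. -/
theorem norm_ballCutoff_smul_sub_le {F : H → H} {R K C : ℝ} (hK : 0 ≤ K) (hC : 0 ≤ C)
    (hlip : ∀ x y : H, ‖x‖ ≤ R + 1 → ‖y‖ ≤ R + 1 → ‖F x - F y‖ ≤ K * ‖x - y‖)
    (hbdd : ∀ x : H, ‖x‖ ≤ R + 1 → ‖F x‖ ≤ C) (x y : H) :
    ‖ballCutoff R x • F x - ballCutoff R y • F y‖ ≤ (K + C) * ‖x - y‖ := by
  have hxy := norm_nonneg (x - y)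
  have hcut := abs_ballCutoff_sub_le R x y
  rcases le_or_gt ‖x‖ (R + 1) with hx | hx
  · rcases le_or_gt ‖y‖ (R + 1) with hy | hy
    · have e : ballCutoff R x • F x - ballCutoff R y • F y =
          ballCutoff R x • (F x - F y) + (ballCutoff R x - ballCutoff R y) • F y := by
        module
      rw [e]
      refine (norm_add_le _ _).trans ?_
      rw [norm_smul, norm_smul, Real.norm_eq_abs, Real.norm_eq_abs,
        abs_of_nonneg (ballCutoff_nonneg R x)]
      have h1 : ballCutoff R x * ‖F x - F y‖ ≤ 1 * (K * ‖x - y‖) :=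
        mul_le_mul (ballCutoff_le_one R x) (hlip x y hx hy) (norm_nonneg _) zero_le_one
      have h2 : |ballCutoff R x - ballCutoff R y| * ‖F y‖ ≤ ‖x - y‖ * C :=
        mul_le_mul hcut (hbdd y hy) (norm_nonneg _) hxy
      linarith
    · have h0 : ballCutoff R y = 0 := ballCutoff_eq_zero hy.le
      rw [h0, sub_zero] at hcut
      rw [h0, zero_smul, sub_zero, norm_smul, Real.norm_eq_abs]
      have h2 : |ballCutoff R x| * ‖F x‖ ≤ ‖x - y‖ * C :=
        mul_le_mul hcut (hbdd x hx) (norm_nonneg _) hxy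
      nlinarith
  · have h0 : ballCutoff R x = 0 := ballCutoff_eq_zero hx.le
    rw [h0, zero_sub, abs_neg] at hcut
    rw [h0, zero_smul, zero_sub, norm_neg, norm_smul, Real.norm_eq_abs]
    rcases le_or_gt ‖y‖ (R + 1) with hy | hy
    · have h2 : |ballCutoff R y| * ‖F y‖ ≤ ‖x - y‖ * C :=
        mul_le_mul hcut (hbdd y hy) (norm_nonneg _) hxy
      nlinarith
    · rw [ballCutoff_eq_zero hy.le, abs_zero, zero_mul]
      positivity

theorem norm_ballCutoff_smul_le {F : H → H} {R C : ℝ} (hC : 0 ≤ C)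
    (hbdd : ∀ x : H, ‖x‖ ≤ R + 1 → ‖F x‖ ≤ C) (x : H) : ‖ballCutoff R x • F x‖ ≤ C := by
  rw [norm_smul, Real.norm_eq_abs, abs_of_nonneg (ballCutoff_nonneg R x)]
  rcases le_or_gt ‖x‖ (R + 1) with hx | hx
  · calc ballCutoff R x * ‖F x‖ ≤ 1 * C :=
          mul_le_mul (ballCutoff_le_one R x) (hbdd x hx) (norm_nonneg _) zero_le_one
      _ = C := one_mul C
  · rw [ballCutoff_eq_zero hx.le, zero_mul]
    exact hC

/-- The derivative of a quadratic form along a curve. -/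
theorem hasDerivAt_inner_symm {D : H →L[ℝ] H} (hD : ∀ x y, inner ℝ (D x) y = inner ℝ x (D y))
    {y : ℝ → H} {y' : H} {t : ℝ} (h : HasDerivAt y y' t) :
    HasDerivAt (fun s => inner ℝ (D (y s)) (y s)) (2 * inner ℝ (D (y t)) y') t := by
  have h1 := (D.hasFDerivAt.comp_hasDerivAt t h).inner ℝ h
  have h2 : inner ℝ (D (y t)) y' + inner ℝ (D y') (y t) = 2 * inner ℝ (D (y t)) y' := by
    rw [hD y' (y t), real_inner_comm (D (y t)) y']
    ring
  exact h2 ▸ h1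

/-- The initial value problem is solvable on `[0, T]` if the vector field is Lipschitz and bounded
on balls and some equivalent energy grows at most linearly along it. -/
theorem exists_solution_of_energy [CompleteSpace H] {F : ℝ → H → H}
    (hcont : ∀ x, Continuous fun t => F t x)
    (hlip : ∀ R : ℝ, ∃ K, 0 ≤ K ∧ ∀ t, ∀ x y : H, ‖x‖ ≤ R → ‖y‖ ≤ R →
      ‖F t x - F t y‖ ≤ K * ‖x - y‖)
    (hbdd : ∀ R : ℝ, ∃ C, 0 ≤ C ∧ ∀ t, ∀ x : H, ‖x‖ ≤ R → ‖F t x‖ ≤ C)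
    {D : H →L[ℝ] H} (hD : ∀ x y, inner ℝ (D x) y = inner ℝ x (D y))
    {c : ℝ} (hc : 0 < c) (hDc : ∀ x, c * ‖x‖ ^ 2 ≤ inner ℝ (D x) x)
    {C : ℝ} (hC : 0 ≤ C) (henergy : ∀ t x, 2 * inner ℝ (D x) (F t x) ≤ C)
    (x₀ : H) {T : ℝ} (hT : 0 ≤ T) :
    ∃ y : ℝ → H, y 0 = x₀ ∧ ContinuousOn y (Set.Icc 0 T) ∧
      ∀ t ∈ Set.Ioo 0 T, HasDerivAt y (F t (y t)) t := by
  set V₀ : ℝ := inner ℝ (D x₀) x₀ with hV₀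
  have hV₀' : 0 ≤ V₀ := le_trans (by positivity) (hDc x₀)
  -- The largest norm compatible with an energy of at most `V₀ + C * T`. The cut-off at this radius
  -- makes the field globally bounded and Lipschitz, and the solution never leaves the region where
  -- the cut-off is `1`.
  set R : ℝ := Real.sqrt ((V₀ + C * T) / c) with hR
  have hRsq : c * R ^ 2 = V₀ + C * T := by
    rw [hR, Real.sq_sqrt (by positivity)]
    field_simp
  obtain ⟨K, hK, hlip⟩ := hlip (R + 1)
  obtain ⟨L, hL, hbdd⟩ := hbdd (R + 1)
  have hPL : IsPicardLindelof (fun t x => ballCutoff R x • F t x) (tmin := 0) (tmax := T)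
      ⟨0, le_rfl, hT⟩ x₀ ⟨L * T, by positivity⟩ 0 ⟨L, hL⟩ ⟨K + L, by positivity⟩ := by
    refine ⟨fun t _ => ?_, fun x _ => ?_, fun t _ x _ => ?_, ?_⟩
    · refine LipschitzOnWith.of_dist_le_mul fun x _ y _ => ?_
      rw [dist_eq_norm, dist_eq_norm]
      exact norm_ballCutoff_smul_sub_le hK hL (hlip t) (hbdd t) x y
    · exact (continuous_const.smul (hcont x)).continuousOn
    · exact norm_ballCutoff_smul_le hL (hbdd t) x
    · simp only [sub_zero, sub_self, max_eq_left hT, NNReal.coe_zero]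
      exact le_refl (L * T)
  obtain ⟨y, hy0, hy⟩ := hPL.exists_eq_forall_mem_Icc_hasDerivWithinAt₀
  have hy0 : y 0 = x₀ := hy0
  have hyc : ContinuousOn y (Set.Icc 0 T) := fun t ht => (hy t ht).continuousWithinAt
  have hyd : ∀ t ∈ Set.Ioo 0 T, HasDerivAt y (ballCutoff R (y t) • F t (y t)) t := fun t ht =>
    (hy t (Set.Ioo_subset_Icc_self ht)).hasDerivAt (Icc_mem_nhds ht.1 ht.2)
  have hbound : ∀ t ∈ Set.Icc 0 T, ‖y t‖ ≤ R := by
    intro t ht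
    have h1 : inner ℝ (D (y t)) (y t) - inner ℝ (D (y 0)) (y 0) ≤ C * (t - 0) := by
      refine (convex_Icc (0 : ℝ) T).image_sub_le_mul_sub_of_deriv_le
        (f := fun s => inner ℝ (D (y s)) (y s))
        (ContinuousOn.inner (𝕜 := ℝ) (D.continuous.comp_continuousOn hyc) hyc)
        ?_ ?_ 0 ⟨le_rfl, hT⟩ t ht ht.1
      · intro s hs
        rw [interior_Icc] at hs
        exact (hasDerivAt_inner_symm hD (hyd s hs)).differentiableAt.differentiableWithinAt
      · intro s hs
        rw [interior_Icc] at hs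
        rw [(hasDerivAt_inner_symm hD (hyd s hs)).deriv, inner_smul_right]
        -- The energy bound survives the cut-off, since the factor lies in `[0, 1]` and `C ≥ 0`.
        have h1 := henergy s (y s)
        have h2 := ballCutoff_nonneg R (y s)
        have h3 := ballCutoff_le_one R (y s)
        nlinarith
    rw [hy0, ← hV₀] at h1
    have h2 := hDc (y t)
    have h3 : C * t ≤ C * T := mul_le_mul_of_nonneg_left ht.2 hC
    have h4 : c * ‖y t‖ ^ 2 ≤ c * R ^ 2 := by rw [hRsq]; linarith
    exact le_of_sq_le_sq (le_of_mul_le_mul_left h4 hc) (Real.sqrt_nonneg _)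
  refine ⟨y, hy0, hyc, fun t ht => ?_⟩
  have h1 := hyd t ht
  rwa [ballCutoff_eq_one (hbound t (Set.Ioo_subset_Icc_self ht)), one_smul] at h1

/-- Continuous dependence of solutions on the initial value and on the vector field. -/
theorem norm_sub_sq_le_of_solutions {F G : ℝ → H → H} {R K δ T : ℝ} (hK : 0 ≤ K)
    (hlip : ∀ t, ∀ x y : H, ‖x‖ ≤ R → ‖y‖ ≤ R → ‖F t x - G t y‖ ≤ K * ‖x - y‖ + δ)
    {y z : ℝ → H} (hy : ContinuousOn y (Set.Icc 0 T)) (hz : ContinuousOn z (Set.Icc 0 T))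
    (hyd : ∀ t ∈ Set.Ioo 0 T, HasDerivAt y (F t (y t)) t)
    (hzd : ∀ t ∈ Set.Ioo 0 T, HasDerivAt z (G t (z t)) t)
    (hyR : ∀ t ∈ Set.Ioo 0 T, ‖y t‖ ≤ R) (hzR : ∀ t ∈ Set.Ioo 0 T, ‖z t‖ ≤ R)
    {t : ℝ} (ht : t ∈ Set.Icc 0 T) :
    ‖y t - z t‖ ^ 2 ≤ Real.exp ((2 * K + 1) * t) * (‖y 0 - z 0‖ ^ 2 + δ ^ 2) := by
  -- The difference `w` satisfies `(‖w‖²)' ≤ 2K‖w‖² + 2δ‖w‖ ≤ (2K + 1)‖w‖² + δ²`, which is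
  -- Grönwall's form with a negative rate.
  have h := le_exp_of_deriv_le (g := fun t => ‖y t - z t‖ ^ 2) (c := -(2 * K + 1))
    (K := -(δ ^ 2 / (2 * K + 1))) ((hy.sub hz).norm.pow 2)
    (fun s hs => ((hyd s hs).sub (hzd s hs)).norm_sq) (fun s hs => ?_) ht
  · have h0 : δ ^ 2 / (2 * K + 1) ≤ δ ^ 2 := div_le_self (sq_nonneg _) (by linarith)
    have h1 : 0 ≤ δ ^ 2 / (2 * K + 1) := by positivity
    have h2 : -(-(2 * K + 1) * t) = (2 * K + 1) * t := by ring
    rw [h2] at h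
    have h3 := Real.exp_pos ((2 * K + 1) * t)
    refine h.trans ?_
    nlinarith
  · have h1 := hlip s (y s) (z s) (hyR s hs) (hzR s hs)
    have h2 := real_inner_le_norm (y s - z s) (F s (y s) - G s (z s))
    have h3 : ‖y s - z s‖ * ‖F s (y s) - G s (z s)‖ ≤
        ‖y s - z s‖ * (K * ‖y s - z s‖ + δ) :=
      mul_le_mul_of_nonneg_left h1 (norm_nonneg _)
    have h4 : -(2 * K + 1) * (-(δ ^ 2 / (2 * K + 1)) - ‖y s - z s‖ ^ 2) =
        δ ^ 2 + (2 * K + 1) * ‖y s - z s‖ ^ 2 := by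
      have : 2 * K + 1 ≠ 0 := by positivity
      field_simp
      ring
    rw [h4]
    simp only [Pi.sub_apply]
    nlinarith [sq_nonneg (‖y s - z s‖ - δ)]

/-- Uniqueness of solutions for vector fields that are Lipschitz on balls. -/
theorem eqOn_of_solutions {F : ℝ → H → H}
    (hlip : ∀ R : ℝ, ∃ K, 0 ≤ K ∧ ∀ t, ∀ x y : H, ‖x‖ ≤ R → ‖y‖ ≤ R →
      ‖F t x - F t y‖ ≤ K * ‖x - y‖) {T : ℝ}
    {y z : ℝ → H} (hy : ContinuousOn y (Set.Icc 0 T)) (hz : ContinuousOn z (Set.Icc 0 T))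
    (hyd : ∀ t ∈ Set.Ioo 0 T, HasDerivAt y (F t (y t)) t)
    (hzd : ∀ t ∈ Set.Ioo 0 T, HasDerivAt z (F t (z t)) t)
    (h0 : y 0 = z 0) : Set.EqOn y z (Set.Icc 0 T) := by
  obtain ⟨Ry, hRy⟩ := isCompact_Icc.exists_bound_of_continuousOn hy
  obtain ⟨Rz, hRz⟩ := isCompact_Icc.exists_bound_of_continuousOn hz
  obtain ⟨K, hK, hlip⟩ := hlip (max Ry Rz)
  intro t ht
  have h := norm_sub_sq_le_of_solutions (δ := 0) hK (by simpa using hlip) hy hz hyd hzd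
    (fun s hs => (hRy s (Set.Ioo_subset_Icc_self hs)).trans (le_max_left _ _))
    (fun s hs => (hRz s (Set.Ioo_subset_Icc_self hs)).trans (le_max_right _ _)) ht
  rw [h0, sub_self, norm_zero] at h
  have h1 : ‖y t - z t‖ ^ 2 ≤ 0 := by simpa using h
  exact sub_eq_zero.1 (norm_eq_zero.1 (pow_eq_zero_iff two_ne_zero |>.1
    (le_antisymm h1 (sq_nonneg _))))

/-- Under the hypotheses of `exists_solution_of_energy` there are solutions on `[0, ∞)`. -/
theorem exists_global_solution_of_energy [CompleteSpace H] {F : ℝ → H → H}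
    (hcont : ∀ x, Continuous fun t => F t x)
    (hlip : ∀ R : ℝ, ∃ K, 0 ≤ K ∧ ∀ t, ∀ x y : H, ‖x‖ ≤ R → ‖y‖ ≤ R →
      ‖F t x - F t y‖ ≤ K * ‖x - y‖)
    (hbdd : ∀ R : ℝ, ∃ C, 0 ≤ C ∧ ∀ t, ∀ x : H, ‖x‖ ≤ R → ‖F t x‖ ≤ C)
    {D : H →L[ℝ] H} (hD : ∀ x y, inner ℝ (D x) y = inner ℝ x (D y))
    {c : ℝ} (hc : 0 < c) (hDc : ∀ x, c * ‖x‖ ^ 2 ≤ inner ℝ (D x) x)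
    {C : ℝ} (hC : 0 ≤ C) (henergy : ∀ t x, 2 * inner ℝ (D x) (F t x) ≤ C) (x₀ : H) :
    ∃ y : ℝ → H, y 0 = x₀ ∧ ContinuousOn y (Set.Ici 0) ∧
      ∀ t, 0 < t → HasDerivAt y (F t (y t)) t := by
  choose w hw0 hwc hwd using fun n : ℕ =>
    exists_solution_of_energy hcont hlip hbdd hD hc hDc hC henergy x₀ (T := n) n.cast_nonneg
  have heq : ∀ m n : ℕ, m ≤ n → Set.EqOn (w m) (w n) (Set.Icc 0 m) := by
    intro m n hmn
    have hmn' : (m : ℝ) ≤ n := by exact_mod_cast hmn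
    exact eqOn_of_solutions hlip (hwc m) ((hwc n).mono (Set.Icc_subset_Icc_right hmn')) (hwd m)
      (fun t ht => hwd n t ⟨ht.1, ht.2.trans_le hmn'⟩) ((hw0 m).trans (hw0 n).symm)
  -- The `+ 1` puts `t` strictly below the right end of the interval, so that `y` agrees with one `w
  -- n` near `t`.
  set y : ℝ → H := fun t => w (⌈t⌉₊ + 1) t with hy
  have hyw : ∀ n : ℕ, Set.EqOn y (w n) (Set.Icc 0 n) := by
    intro n t ht
    have ht2 : t ≤ ((⌈t⌉₊ + 1 : ℕ) : ℝ) := (Nat.le_ceil t).trans (by push_cast; linarith)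
    rcases le_total n (⌈t⌉₊ + 1) with h | h
    · exact (heq _ _ h ht).symm
    · exact heq _ _ h ⟨ht.1, ht2⟩
  have hlt : ∀ t : ℝ, t < ((⌈t⌉₊ + 1 : ℕ) : ℝ) := fun t =>
    (Nat.le_ceil t).trans_lt (by push_cast; linarith)
  refine ⟨y, hw0 _, fun t ht => ?_, fun t ht => ?_⟩
  · set n := ⌈t⌉₊ + 1 with hn
    have h1 : ContinuousWithinAt y (Set.Icc 0 n) t :=
      ((hwc n).congr (hyw n)) t ⟨ht, (hlt t).le⟩
    refine h1.mono_of_mem_nhdsWithin ?_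
    rw [← Set.Ici_inter_Iic]
    exact inter_mem self_mem_nhdsWithin (mem_nhdsWithin_of_mem_nhds (Iic_mem_nhds (hlt t)))
  · set n := ⌈t⌉₊ + 1 with hn
    have h1 := hwd n t ⟨ht, hlt t⟩
    rw [← hyw n ⟨ht.le, (hlt t).le⟩] at h1
    refine h1.congr_of_eventuallyEq ?_
    filter_upwards [Icc_mem_nhds ht (hlt t)] with s hs using hyw n hs

end GlobalExistence

/-! ### Operators on square-summable sequences -/

namespace EllTwo

theorem hasSum_sq (u : EllTwo) : HasSum (fun m => u m ^ 2) (‖u‖ ^ 2) := by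
  have h := lp.hasSum_norm (p := 2) (by norm_num) u
  simpa using h

theorem summable_sq (u : EllTwo) : Summable fun m => u m ^ 2 := (hasSum_sq u).summable

theorem abs_apply_le (u : EllTwo) (m : ℤ) : |u m| ≤ ‖u‖ :=
  lp.norm_apply_le_norm (by norm_num) u m

theorem memℓp_of_summable_sq {g : ℤ → ℝ} (h : Summable fun m => g m ^ 2) :
    Memℓp (E := fun _ : ℤ => ℝ) g 2 :=
  memℓp_gen (by simpa using h)

theorem memℓp_of_abs_le {g : ℤ → ℝ} {u : EllTwo} {C : ℝ} (h : ∀ m, |g m| ≤ C * |u m|) :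
    Memℓp (E := fun _ : ℤ => ℝ) g 2 := by
  refine memℓp_of_summable_sq (Summable.of_nonneg_of_le (fun m => sq_nonneg _) (fun m => ?_)
    ((summable_sq u).mul_left (C ^ 2)))
  have h1 := h m
  rw [← sq_abs (g m), ← sq_abs (u m), ← mul_pow]
  exact pow_le_pow_left₀ (abs_nonneg _) h1 2

theorem norm_le_of_abs_le {g u : EllTwo} {C : ℝ} (hC : 0 ≤ C) (h : ∀ m, |g m| ≤ C * |u m|) :
    ‖g‖ ≤ C * ‖u‖ := by
  refine le_of_sq_le_sq ?_ (by positivity)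
  rw [mul_pow]
  refine hasSum_le (fun m => ?_) (hasSum_sq g) ((hasSum_sq u).mul_left (C ^ 2))
  rw [← sq_abs (g m), ← sq_abs (u m), ← mul_pow]
  exact pow_le_pow_left₀ (abs_nonneg _) (h m) 2

theorem abs_mul_le (u v : EllTwo) (m : ℤ) : |u m * v m| ≤ ‖u‖ * |v m| := by
  rw [abs_mul]
  exact mul_le_mul_of_nonneg_right (abs_apply_le u m) (abs_nonneg _)

theorem summable_mul (u v : EllTwo) : Summable fun m => u m * v m := by
  have h := lp.summable_inner (𝕜 := ℝ) v u
  simpa using h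

/-- The pointwise product of square-summable sequences. -/
noncomputable def mul (u v : EllTwo) : EllTwo :=
  ⟨fun m => u m * v m, memℓp_of_abs_le (abs_mul_le u v)⟩

theorem norm_mul_le (u v : EllTwo) : ‖mul u v‖ ≤ ‖u‖ * ‖v‖ :=
  norm_le_of_abs_le (norm_nonneg u) (abs_mul_le u v)

/-- Multiplication by a bounded sequence. -/
noncomputable def weight (w : ℤ → ℝ) {C : ℝ} (hC : 0 ≤ C) (hw : ∀ m, |w m| ≤ C) :
    EllTwo →L[ℝ] EllTwo :=
  LinearMap.mkContinuous
    { toFun := fun u => ⟨fun m => w m * u m, memℓp_of_abs_le (C := C) (u := u) fun m => by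
        rw [abs_mul]; exact mul_le_mul_of_nonneg_right (hw m) (abs_nonneg _)⟩
      map_add' := fun u v => lp.ext (funext fun m => mul_add (w m) (u m) (v m))
      map_smul' := fun c u => lp.ext (funext fun m => mul_left_comm (w m) c (u m)) } C
    fun u => norm_le_of_abs_le hC fun m => by
      change |w m * u m| ≤ _
      rw [abs_mul]; exact mul_le_mul_of_nonneg_right (hw m) (abs_nonneg _)

@[simp] theorem weight_apply (w : ℤ → ℝ) {C : ℝ} (hC : 0 ≤ C) (hw : ∀ m, |w m| ≤ C) (u : EllTwo)
    (m : ℤ) : weight w hC hw u m = w m * u m := rfl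

theorem hasSum_sq_shift (u : EllTwo) (j : ℤ) : HasSum (fun m => u (m + j) ^ 2) (‖u‖ ^ 2) :=
  (Equiv.addRight j).hasSum_iff (f := fun m => u m ^ 2) |>.2 (hasSum_sq u)

/-- The shift by `j`. -/
noncomputable def shift (j : ℤ) : EllTwo →L[ℝ] EllTwo :=
  LinearMap.mkContinuous
    { toFun := fun u => ⟨fun m => u (m + j), memℓp_of_summable_sq (hasSum_sq_shift u j).summable⟩
      map_add' := fun _ _ => rfl
      map_smul' := fun _ _ => rfl } 1
    fun u => by
      rw [one_mul]
      refine le_of_sq_le_sq (le_of_eq ?_) (norm_nonneg _)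
      exact (hasSum_sq _).unique (hasSum_sq_shift u j)

/-- The discrete Laplacian `A` as an operator on `ℓ²`. -/
noncomputable def lap : EllTwo →L[ℝ] EllTwo :=
  (2 : ℝ) • ContinuousLinearMap.id ℝ EllTwo - shift 1 - shift (-1)

@[simp] theorem lap_apply (u : EllTwo) (m : ℤ) : lap u m = latticeA u m := rfl

/-- The weighted quadratic form of the discrete Laplacian is bounded below in terms of the second
differences of the weight. -/
theorem neg_two_mul_tsum_weight_lap_le {η : ℤ → ℝ} (hη : ∀ m, 0 ≤ η m) (hη1 : ∀ m, η m ≤ 1) {δ : ℝ}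
    (hδ : ∀ m, η (m + 1) + η (m - 1) - 2 * η m ≤ δ) (u : EllTwo) :
    -2 * ∑' m, η m * (u m * latticeA u m) ≤ δ * ‖u‖ ^ 2 := by
  have hbd : ∀ m, |η m| ≤ 1 := fun m => by rw [abs_of_nonneg (hη m)]; exact hη1 m
  have hs : ∀ j : ℤ, Summable fun m => η m * u (m + j) ^ 2 := fun j => by
    refine Summable.of_nonneg_of_le (fun m => mul_nonneg (hη m) (sq_nonneg _)) (fun m => ?_)
      (hasSum_sq_shift u j).summable
    exact mul_le_of_le_one_left (sq_nonneg _) (hη1 m)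
  have hs' : ∀ j : ℤ, Summable fun m => η (m - j) * u m ^ 2 := fun j => by
    refine ((Equiv.addRight j).summable_iff (f := fun m => η (m - j) * u m ^ 2)).1 ?_
    simpa [Function.comp_def] using hs j
  have he : ∀ j : ℤ, ∑' m, η m * u (m + j) ^ 2 = ∑' m, η (m - j) * u m ^ 2 := fun j => by
    rw [← (Equiv.addRight j).tsum_eq fun m => η (m - j) * u m ^ 2]
    simp
  have hlap : Summable fun m => η m * (u m * latticeA u m) := by
    have := summable_mul (weight η zero_le_one hbd u) (lap u)
    simpa [mul_assoc] using this
  -- Here `-2u(2u - u₊ - u₋) = u₊² + u₋² - 2u² - (u - u₊)² - (u - u₋)²`, and the last two squares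
  -- are dropped.
  have h0 : ∀ m, -2 * (η m * (u m * latticeA u m)) ≤
      (η m * u (m + 1) ^ 2 + η m * u (m + -1) ^ 2) - 2 * (η m * u (m + 0) ^ 2) := by
    intro m
    rw [latticeA, add_zero, ← sub_eq_add_neg]
    have h1 : 0 ≤ η m * (u m - u (m + 1)) ^ 2 := mul_nonneg (hη m) (sq_nonneg _)
    have h2 : 0 ≤ η m * (u m - u (m - 1)) ^ 2 := mul_nonneg (hη m) (sq_nonneg _)
    nlinarith
  calc -2 * ∑' m, η m * (u m * latticeA u m)
      = ∑' m, -2 * (η m * (u m * latticeA u m)) := tsum_mul_left.symm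
    _ ≤ ∑' m, ((η m * u (m + 1) ^ 2 + η m * u (m + -1) ^ 2) - 2 * (η m * u (m + 0) ^ 2)) :=
        (hlap.mul_left _).tsum_le_tsum h0 (((hs 1).add (hs (-1))).sub ((hs 0).mul_left 2))
    -- Summation by parts: shifting the index moves the second difference from `u²` to `η`.
    _ = ∑' m, ((η (m - 1) * u m ^ 2 + η (m - -1) * u m ^ 2) - 2 * (η (m - 0) * u m ^ 2)) := by
        rw [((hs 1).add (hs (-1))).tsum_sub ((hs 0).mul_left 2), (hs 1).tsum_add (hs (-1)),
          tsum_mul_left, he, he, he, ((hs' 1).add (hs' (-1))).tsum_sub ((hs' 0).mul_left 2),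
          (hs' 1).tsum_add (hs' (-1)), tsum_mul_left]
    _ ≤ ∑' m, δ * u m ^ 2 := by
        refine (((hs' 1).add (hs' (-1))).sub ((hs' 0).mul_left 2)).tsum_le_tsum (fun m => ?_)
          ((summable_sq u).mul_left δ)
        have h1 := hδ m
        rw [sub_neg_eq_add, sub_zero]
        nlinarith [sq_nonneg (u m)]
    _ = δ * ‖u‖ ^ 2 := by rw [tsum_mul_left, (hasSum_sq u).tsum_eq]

end EllTwo

/-! ### Weighted quadratic forms and truncations on the phase space -/

namespace PhaseSpace

theorem norm_sq_eq (φ : PhaseSpace) : ‖φ‖ ^ 2 = ∑ i, ‖φ i‖ ^ 2 := PiLp.norm_sq_eq_of_L2 _ φ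

theorem norm_apply_le (φ : PhaseSpace) (i : Fin 3) : ‖φ i‖ ≤ ‖φ‖ := PiLp.norm_apply_le φ i

theorem norm_le_sum (φ : PhaseSpace) : ‖φ‖ ≤ ∑ i, ‖φ i‖ := by
  refine le_of_sq_le_sq ?_ (Finset.sum_nonneg fun _ _ => norm_nonneg _)
  rw [norm_sq_eq]
  simp only [Fin.sum_univ_three]
  have h0 := norm_nonneg (φ 0)
  have h1 := norm_nonneg (φ 1)
  have h2 := norm_nonneg (φ 2)
  nlinarith [mul_nonneg h0 h1, mul_nonneg h0 h2, mul_nonneg h1 h2]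

theorem inner_eq (φ ψ : PhaseSpace) : inner ℝ φ ψ = ∑ i, ∑' m, φ i m * ψ i m := by
  rw [PiLp.inner_apply]
  refine Finset.sum_congr rfl fun i _ => ?_
  rw [lp.inner_eq_tsum]
  refine tsum_congr fun m => ?_
  simp [mul_comm]

/-- The operator multiplying the `i`-th component at the site `m` by `c i * η m`. -/
noncomputable def diag (c : Fin 3 → ℝ) (η : ℤ → ℝ) {C : ℝ} (hC : 0 ≤ C) (hη : ∀ m, |η m| ≤ C) :
    PhaseSpace →L[ℝ] PhaseSpace :=
  ((PiLp.continuousLinearEquiv 2 ℝ (fun _ : Fin 3 => EllTwo)).symm :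
      (Fin 3 → EllTwo) →L[ℝ] PhaseSpace).comp
    (ContinuousLinearMap.pi fun i => c i • (EllTwo.weight η hC hη).comp
      (PiLp.proj 2 (fun _ : Fin 3 => EllTwo) i))

@[simp] theorem diag_apply (c : Fin 3 → ℝ) (η : ℤ → ℝ) {C : ℝ} (hC : 0 ≤ C) (hη : ∀ m, |η m| ≤ C)
    (φ : PhaseSpace) (i : Fin 3) (m : ℤ) : diag c η hC hη φ i m = c i * (η m * φ i m) := rfl

theorem inner_diag (c : Fin 3 → ℝ) (η : ℤ → ℝ) {C : ℝ} (hC : 0 ≤ C) (hη : ∀ m, |η m| ≤ C)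
    (φ ψ : PhaseSpace) :
    inner ℝ (diag c η hC hη φ) ψ = ∑ i, c i * ∑' m, η m * (φ i m * ψ i m) := by
  rw [inner_eq]
  refine Finset.sum_congr rfl fun i _ => ?_
  rw [← tsum_mul_left]
  refine tsum_congr fun m => ?_
  rw [diag_apply]
  ring

theorem inner_diag_symm (c : Fin 3 → ℝ) (η : ℤ → ℝ) {C : ℝ} (hC : 0 ≤ C) (hη : ∀ m, |η m| ≤ C)
    (φ ψ : PhaseSpace) : inner ℝ (diag c η hC hη φ) ψ = inner ℝ φ (diag c η hC hη ψ) := by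
  rw [inner_diag, ← real_inner_comm, inner_diag]
  simp only [mul_comm (ψ _ _)]

/-- The part of `φ` supported on the sites `|m| < N`. -/
noncomputable def truncate (N : ℕ) (φ : PhaseSpace) : PhaseSpace :=
  diag 1 (fun m => if |m| < N then 1 else 0) zero_le_one
    (fun m => by split_ifs <;> simp) φ

theorem summable_indicator_sq (φ : PhaseSpace) (i : Fin 3) (N : ℕ) :
    Summable fun m : ℤ => if |m| < (N : ℤ) then 0 else φ i m ^ 2 := by
  refine Summable.of_nonneg_of_le (fun m => ?_) (fun m => ?_) (EllTwo.summable_sq (φ i)) <;>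
  · dsimp only
    split_ifs <;> first | exact le_rfl | exact sq_nonneg _

theorem norm_sub_truncate_sq (N : ℕ) (φ : PhaseSpace) :
    ‖φ - truncate N φ‖ ^ 2 = ∑ i, ∑' m : ℤ, if |m| < (N : ℤ) then 0 else φ i m ^ 2 := by
  rw [norm_sq_eq]
  refine Finset.sum_congr rfl fun i _ => ?_
  rw [← (EllTwo.hasSum_sq _).tsum_eq]
  refine tsum_congr fun m => ?_
  change (φ i m - truncate N φ i m) ^ 2 = _
  rw [truncate, diag_apply]
  split_ifs <;> simp

/-- The truncations of the elements of a ball form a totally bounded set. -/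
theorem totallyBounded_truncate (N : ℕ) (R : ℝ) :
    TotallyBounded (truncate N '' Metric.closedBall 0 R) := by
  classical
  let s : Finset ℤ := Finset.Ioo (-(N : ℤ)) N
  let Q : (Fin 3 → s → ℝ) → PhaseSpace := fun g =>
    WithLp.toLp 2 fun i => ∑ m : s, lp.single 2 (m : ℤ) (g i m)
  have hQ : Continuous Q := by
    refine (PiLp.continuous_toLp 2 _).comp (continuous_pi fun i => ?_)
    refine continuous_finsetSum _ fun m _ => ?_
    exact (lp.isometry_single (p := 2) (E := fun _ : ℤ => ℝ) (m : ℤ)).continuous.comp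
      (by fun_prop)
  -- The truncations lie in the continuous image of a ball of a finite-dimensional space; `max R 0`
  -- makes the radius nonnegative for the sup-norm criterion.
  have hK : IsCompact (Q '' Metric.closedBall 0 (max R 0)) :=
    (isCompact_closedBall _ _).image hQ
  refine hK.totallyBounded.subset ?_
  rintro _ ⟨φ, hφ, rfl⟩
  rw [mem_closedBall_zero_iff] at hφ
  refine ⟨fun i m => φ i m, ?_, ?_⟩
  · rw [mem_closedBall_zero_iff]
    refine (pi_norm_le_iff_of_nonneg (le_max_right _ _)).2 fun i =>
      (pi_norm_le_iff_of_nonneg (le_max_right _ _)).2 fun m => ?_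
    exact (EllTwo.abs_apply_le (φ i) m).trans
      ((norm_apply_le φ i).trans (hφ.trans (le_max_left _ _)))
  · ext i m
    change (∑ j : s, lp.single 2 (j : ℤ) (φ i j) : EllTwo) m = truncate N φ i m
    rw [truncate, diag_apply, lp.coeFn_sum, Finset.sum_apply,
      Finset.sum_coe_sort s (fun j => (lp.single 2 j (φ i j) : EllTwo) m)]
    simp only [lp.single_apply, Pi.single_apply]
    have hmem : m ∈ s ↔ |m| < (N : ℤ) := by rw [Finset.mem_Ioo, abs_lt]
    by_cases hm : |m| < (N : ℤ)
    · simp [hm, hmem.2 hm]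
    · have : m ∉ s := fun h => hm (hmem.1 h)
      simp [hm, this]

end PhaseSpace

/-! ### Calculus of maps that are Lipschitz on balls -/

section LipschitzOnBalls

variable {X Y : Type*} [NormedAddCommGroup X] [NormedAddCommGroup Y]

/-- A map is Lipschitz on every ball centred at `0`. -/
def LipschitzOnBalls (f : X → Y) : Prop :=
  ∀ R : ℝ, ∃ K, 0 ≤ K ∧ ∀ x y : X, ‖x‖ ≤ R → ‖y‖ ≤ R → ‖f x - f y‖ ≤ K * ‖x - y‖

theorem LipschitzOnBalls.add {f g : X → Y} (hf : LipschitzOnBalls f) (hg : LipschitzOnBalls g) :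
    LipschitzOnBalls fun x => f x + g x := by
  intro R
  obtain ⟨K, hK, hf⟩ := hf R
  obtain ⟨L, hL, hg⟩ := hg R
  refine ⟨K + L, by positivity, fun x y hx hy => ?_⟩
  rw [add_sub_add_comm, add_mul]
  exact (norm_add_le _ _).trans (add_le_add (hf x y hx hy) (hg x y hx hy))

theorem LipschitzOnBalls.clm_comp [NormedSpace ℝ Y] {Z : Type*} [NormedAddCommGroup Z]
    [NormedSpace ℝ Z] {f : X → Y} (hf : LipschitzOnBalls f) (L : Y →L[ℝ] Z) :
    LipschitzOnBalls fun x => L (f x) := by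
  intro R
  obtain ⟨K, hK, hf⟩ := hf R
  refine ⟨‖L‖ * K, by positivity, fun x y hx hy => ?_⟩
  rw [← map_sub, mul_assoc]
  exact (L.le_opNorm _).trans (mul_le_mul_of_nonneg_left (hf x y hx hy) (norm_nonneg _))

theorem LipschitzOnBalls.const_smul [NormedSpace ℝ Y] {f : X → Y} (hf : LipschitzOnBalls f)
    (c : ℝ) : LipschitzOnBalls fun x => c • f x :=
  hf.clm_comp (c • ContinuousLinearMap.id ℝ Y)

theorem LipschitzOnBalls.sub [NormedSpace ℝ Y] {f g : X → Y} (hf : LipschitzOnBalls f)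
    (hg : LipschitzOnBalls g) :
    LipschitzOnBalls fun x => f x - g x := by
  simpa [sub_eq_add_neg] using hf.add (hg.const_smul (-1))

theorem lipschitzOnBalls_const (y : Y) : LipschitzOnBalls fun _ : X => y :=
  fun _ => ⟨0, le_rfl, fun _ _ _ _ => by simp⟩

theorem lipschitzOnBalls_clm [NormedSpace ℝ X] [NormedSpace ℝ Y] (L : X →L[ℝ] Y) :
    LipschitzOnBalls L :=
  fun _ => ⟨‖L‖, norm_nonneg _, fun x y _ _ => by rw [← map_sub]; exact L.le_opNorm _⟩

theorem LipschitzOnBalls.exists_bound {f : X → Y} (hf : LipschitzOnBalls f) (R : ℝ) :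
    ∃ C, 0 ≤ C ∧ ∀ x : X, ‖x‖ ≤ R → ‖f x‖ ≤ C := by
  obtain ⟨K, hK, hf⟩ := hf R
  refine ⟨‖f 0‖ + K * |R|, by positivity, fun x hx => ?_⟩
  have hR : 0 ≤ R := (norm_nonneg x).trans hx
  have h1 := hf x 0 hx (by simpa using hR)
  rw [sub_zero] at h1
  have h2 : ‖f x‖ ≤ ‖f 0‖ + ‖f x - f 0‖ := norm_le_norm_add_norm_sub' _ _
  have h3 : K * ‖x‖ ≤ K * |R| := mul_le_mul_of_nonneg_left (hx.trans (le_abs_self R)) hK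
  linarith

theorem LipschitzOnBalls.mul {f g : X → EllTwo} (hf : LipschitzOnBalls f)
    (hg : LipschitzOnBalls g) : LipschitzOnBalls fun x => EllTwo.mul (f x) (g x) := by
  intro R
  obtain ⟨A, hA, hfA⟩ := hf.exists_bound R
  obtain ⟨B, hB, hgB⟩ := hg.exists_bound R
  obtain ⟨K, hK, hf⟩ := hf R
  obtain ⟨L, hL, hg⟩ := hg R
  refine ⟨A * L + K * B, by positivity, fun x y hx hy => ?_⟩
  have e : EllTwo.mul (f x) (g x) - EllTwo.mul (f y) (g y) =
      EllTwo.mul (f x) (g x - g y) + EllTwo.mul (f x - f y) (g y) := by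
    refine lp.ext (funext fun m => ?_)
    change f x m * g x m - f y m * g y m = f x m * (g x m - g y m) + (f x m - f y m) * g y m
    ring
  rw [e]
  refine (norm_add_le _ _).trans ?_
  have h1 := (EllTwo.norm_mul_le (f x) (g x - g y)).trans
    (mul_le_mul (hfA x hx) (hg x y hx hy) (norm_nonneg _) hA)
  have h2 := (EllTwo.norm_mul_le (f x - f y) (g y)).trans
    (mul_le_mul (hf x y hx hy) (hgB y hy) (norm_nonneg _) (by positivity))
  linarith

theorem LipschitzOnBalls.phaseSpace {f : X → PhaseSpace}
    (hf : ∀ i, LipschitzOnBalls fun x => f x i) : LipschitzOnBalls f := by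
  intro R
  choose K hK hf using fun i => hf i R
  refine ⟨∑ i, K i, Finset.sum_nonneg fun i _ => hK i, fun x y hx hy => ?_⟩
  rw [Finset.sum_mul]
  exact (PhaseSpace.norm_le_sum _).trans (Finset.sum_le_sum fun i _ => hf i x y hx hy)

end LipschitzOnBalls

/-! ### Compactness of the torus -/

instance Torus.compactSpace (κ : ℕ) : CompactSpace (Torus κ) := by
  have : Fact (0 < 2 * π) := ⟨Real.two_pi_pos⟩
  exact (PiLp.homeomorph 2 (fun _ : Fin κ => AddCircle (2 * π))).symm.compactSpace

theorem Torus.exists_norm_le (κ : ℕ) : ∃ C, 0 ≤ C ∧ ∀ σ : Torus κ, ‖σ‖ ≤ C := by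
  obtain ⟨C, hC⟩ := (isCompact_univ (X := Torus κ)).exists_bound_of_continuousOn
    (f := fun σ => σ) continuousOn_id
  exact ⟨C, (norm_nonneg _).trans (hC 0 trivial), fun σ => hC σ trivial⟩

/-! ### The vector field and its energy inequality -/

namespace GrayScott

variable {κ : ℕ} (P : GrayScott κ)

/-- The `f i m` vanish at `0` and are uniformly Lipschitz on a torus of finite diameter. -/
theorem H2.exists_bound {P : GrayScott κ} (h2 : P.H2) :
    ∃ K, 0 ≤ K ∧ ∀ i m σ, |P.f i m σ| ≤ K := by
  obtain ⟨h0, c, hc, hlip⟩ := h2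
  obtain ⟨C, hC, hσ⟩ := Torus.exists_norm_le κ
  refine ⟨(∑ i, c i) * C, mul_nonneg (Finset.sum_nonneg fun i _ => (hc i).le) hC,
    fun i m σ => ?_⟩
  have h := hlip i m σ 0
  rw [h0, sub_zero, sub_zero] at h
  refine h.trans (mul_le_mul ?_ (hσ σ) (norm_nonneg _) (Finset.sum_nonneg fun i _ => (hc i).le))
  exact Finset.single_le_sum (fun i _ => (hc i).le) (Finset.mem_univ i)

theorem θ_add (s t : ℝ) (σ : Torus κ) : P.θ (s + t) σ = P.θ s (P.θ t σ) := by
  ext i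
  simp [θ, mul_add, add_assoc]

@[simp] theorem θ_zero (σ : Torus κ) : P.θ 0 σ = σ := by
  ext i
  simp [θ]

@[simp] theorem θ_sub (t : ℝ) (σ τ : Torus κ) : P.θ t σ - P.θ t τ = σ - τ := by
  ext i
  simp [θ]

@[simp] theorem θ_neg_θ (t : ℝ) (σ : Torus κ) : P.θ (-t) (P.θ t σ) = σ := by
  rw [← θ_add, neg_add_cancel, θ_zero]

@[simp] theorem θ_θ_neg (t : ℝ) (σ : Torus κ) : P.θ t (P.θ (-t) σ) = σ := by
  rw [← θ_add, add_neg_cancel, θ_zero]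

theorem continuous_θ_left (σ : Torus κ) : Continuous fun t => P.θ t σ := by
  refine (PiLp.continuous_toLp 2 _).comp (continuous_pi fun i => ?_)
  exact ((AddCircle.continuous_mk' (2 * π)).comp (by fun_prop)).add continuous_const

/-- The diffusion coefficients. -/
def diffusion : Fin 3 → ℝ := ![P.d₁, P.d₂, P.d₃]

/-- The autonomous terms without diffusion. -/
noncomputable def reaction (φ : PhaseSpace) : PhaseSpace :=
  WithLp.toLp 2 ![
    (-(P.lam + P.k)) • φ 0 + EllTwo.mul (φ 0) (EllTwo.mul (φ 0) (φ 1 - P.α • φ 0)) + P.β • φ 2,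
    P.lam • (P.a - φ 1) - EllTwo.mul (φ 0) (EllTwo.mul (φ 0) (φ 1 - P.α • φ 0)),
    P.k • φ 0 - (P.lam + P.β) • φ 2]

theorem reaction_zero (φ : PhaseSpace) (m : ℤ) : P.reaction φ 0 m =
    -(P.lam + P.k) * φ 0 m + φ 0 m * (φ 0 m * (φ 1 m - P.α * φ 0 m)) + P.β * φ 2 m := rfl

theorem reaction_one (φ : PhaseSpace) (m : ℤ) : P.reaction φ 1 m =
    P.lam * (P.a m - φ 1 m) - φ 0 m * (φ 0 m * (φ 1 m - P.α * φ 0 m)) := rfl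

theorem reaction_two (φ : PhaseSpace) (m : ℤ) : P.reaction φ 2 m =
    P.k * φ 0 m - (P.lam + P.β) * φ 2 m := rfl

variable {K : ℝ} (hK0 : 0 ≤ K) (hK : ∀ i m σ, |P.f i m σ| ≤ K)

/-- The forcing term. -/
noncomputable def force (σ : Torus κ) : PhaseSpace :=
  WithLp.toLp 2 fun i => EllTwo.weight (fun m => P.f i m σ) hK0 (fun m => hK i m σ) (P.b i)

theorem force_apply (σ : Torus κ) (i : Fin 3) (m : ℤ) :
    P.force hK0 hK σ i m = P.f i m σ * P.b i m := rfl

/-- The right-hand side of the system as a vector field on the phase space. -/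
noncomputable def field (σ : Torus κ) (φ : PhaseSpace) : PhaseSpace :=
  WithLp.toLp 2 fun i => -P.diffusion i • EllTwo.lap (φ i) + P.reaction φ i + P.force hK0 hK σ i

theorem field_apply (σ : Torus κ) (φ : PhaseSpace) (i : Fin 3) (m : ℤ) :
    P.field hK0 hK σ φ i m =
      -P.diffusion i * latticeA (φ i) m + P.reaction φ i m + P.force hK0 hK σ i m := rfl

theorem field_apply_eq_rhs (σ : Torus κ) (φ : PhaseSpace) (i : Fin 3) (m : ℤ) :
    P.field hK0 hK σ φ i m = P.rhs σ (φ 0) (φ 1) (φ 2) m i := by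
  rw [field_apply, force_apply]
  fin_cases i
  · simp [reaction_zero, rhs, diffusion]; ring
  · simp [reaction_one, rhs, diffusion]; ring
  · simp [reaction_two, rhs, diffusion]; ring

/-- The symbol enters only through the additive force, so Lipschitz constants found at the symbol
`0` serve for every symbol. -/
theorem field_sub (σ τ : Torus κ) (φ ψ : PhaseSpace) :
    P.field hK0 hK σ φ - P.field hK0 hK τ ψ =
      (P.field hK0 hK 0 φ - P.field hK0 hK 0 ψ) + (P.force hK0 hK σ - P.force hK0 hK τ) := by
  have h : ∀ σ φ, P.field hK0 hK σ φ =
      P.field hK0 hK 0 φ - P.force hK0 hK 0 + P.force hK0 hK σ := by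
    intro σ φ
    ext i m
    change P.field hK0 hK σ φ i m =
      P.field hK0 hK 0 φ i m - P.force hK0 hK 0 i m + P.force hK0 hK σ i m
    rw [field_apply, field_apply]
    ring
  rw [h σ φ, h τ ψ]
  abel

theorem lipschitzOnBalls_field (σ : Torus κ) : LipschitzOnBalls (P.field hK0 hK σ) := by
  have hp : ∀ i, LipschitzOnBalls fun φ : PhaseSpace => φ i := fun i =>
    lipschitzOnBalls_clm (PiLp.proj 2 (fun _ : Fin 3 => EllTwo) i : PhaseSpace →L[ℝ] EllTwo)
  have hn := (hp 0).mul ((hp 0).mul ((hp 1).sub ((hp 0).const_smul P.α)))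
  have hr : ∀ i, LipschitzOnBalls fun φ : PhaseSpace => P.reaction φ i := by
    intro i
    fin_cases i
    · exact (((hp 0).const_smul (-(P.lam + P.k))).add hn).add ((hp 2).const_smul P.β)
    · exact (((lipschitzOnBalls_const P.a).sub (hp 1)).const_smul P.lam).sub hn
    · exact ((hp 0).const_smul P.k).sub ((hp 2).const_smul (P.lam + P.β))
  refine LipschitzOnBalls.phaseSpace fun i => ?_
  exact ((((hp i).clm_comp EllTwo.lap).const_smul (-P.diffusion i)).add (hr i)).add
    (lipschitzOnBalls_const _)

theorem H2.exists_norm_force_sub_le {P : GrayScott κ} (h2 : P.H2)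
    (hK : ∀ i m σ, |P.f i m σ| ≤ K) :
    ∃ C, 0 ≤ C ∧ ∀ σ τ, ‖P.force hK0 hK σ - P.force hK0 hK τ‖ ≤ C * ‖σ - τ‖ := by
  obtain ⟨-, c, hc, hlip⟩ := h2
  refine ⟨∑ i, c i * ‖P.b i‖, Finset.sum_nonneg fun i _ =>
    mul_nonneg (hc i).le (norm_nonneg _), fun σ τ => ?_⟩
  rw [Finset.sum_mul]
  refine (PhaseSpace.norm_le_sum _).trans (Finset.sum_le_sum fun i _ => ?_)
  rw [mul_right_comm]
  refine EllTwo.norm_le_of_abs_le (mul_nonneg (hc i).le (norm_nonneg _)) fun m => ?_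
  change |P.f i m σ * P.b i m - P.f i m τ * P.b i m| ≤ _
  rw [← sub_mul, abs_mul]
  exact mul_le_mul_of_nonneg_right (hlip i m σ τ) (abs_nonneg _)

/-- The weights of the components in the energy. -/
noncomputable def energyWeight : Fin 3 → ℝ := ![P.α, 1, P.α * P.β / P.k]

theorem energyWeight_pos {P : GrayScott κ} (hP : P.Standing) (i : Fin 3) : 0 < P.energyWeight i := by
  have h1 := hP.α_pos
  have h2 := hP.β_pos
  have h3 := hP.k_pos
  fin_cases i
  · exact h1
  · exact one_pos
  · exact div_pos (mul_pos h1 h2) h3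

/-- The production of energy at a site. -/
noncomputable def energySource (K : ℝ) (m : ℤ) : ℝ :=
  2 * P.lam * P.a m ^ 2 + P.α / P.lam * (K ^ 2 * P.b 0 m ^ 2) +
    2 / P.lam * (K ^ 2 * P.b 1 m ^ 2) + P.α * P.β / P.k / P.lam * (K ^ 2 * P.b 2 m ^ 2)

theorem summable_energySource (K : ℝ) : Summable (P.energySource K) :=
  ((((EllTwo.summable_sq P.a).mul_left _).add
    (((EllTwo.summable_sq (P.b 0)).mul_left _).mul_left _)).add
    (((EllTwo.summable_sq (P.b 1)).mul_left _).mul_left _)).add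
    (((EllTwo.summable_sq (P.b 2)).mul_left _).mul_left _)

theorem energySource_nonneg {P : GrayScott κ} (hP : P.Standing) (K : ℝ) (m : ℤ) :
    0 ≤ P.energySource K m := by
  have h1 := hP.α_pos
  have h2 := hP.β_pos
  have h3 := hP.k_pos
  have h4 := hP.lam_pos
  unfold energySource
  positivity

/-- The dissipativity of the reaction terms at a site. -/
theorem reaction_energy_le {P : GrayScott κ} (hP : P.Standing)
    (hK : ∀ i m σ, |P.f i m σ| ≤ K) (σ : Torus κ) (φ : PhaseSpace) (m : ℤ) :
    ∑ i, 2 * P.energyWeight i * (φ i m * (P.reaction φ i m + P.force hK0 hK σ i m)) ≤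
      -P.lam * ∑ i, P.energyWeight i * φ i m ^ 2 + P.energySource K m := by
  have hα := hP.α_pos
  have hβ := hP.β_pos
  have hk := hP.k_pos
  have hl := hP.lam_pos
  have hq : ∀ i, 0 ≤ K ^ 2 * P.b i m ^ 2 - P.force hK0 hK σ i m ^ 2 := by
    intro i
    rw [force_apply, mul_pow, ← sub_mul]
    refine mul_nonneg (sub_nonneg.2 ?_) (sq_nonneg _)
    rw [← sq_abs (P.f i m σ)]
    exact pow_le_pow_left₀ (abs_nonneg _) (hK i m σ) 2
  simp only [Fin.sum_univ_three, reaction_zero, reaction_one, reaction_two, energySource]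
  change 2 * P.α * _ + 2 * 1 * _ + 2 * (P.α * P.β / P.k) * _ ≤
    -P.lam * (P.α * _ + 1 * _ + P.α * P.β / P.k * _) + _
  have h0 := hq 0
  have h1 := hq 1
  have h2 := hq 2
  generalize P.force hK0 hK σ 0 m = q₀ at *
  generalize P.force hK0 hK σ 1 m = q₁ at *
  generalize P.force hK0 hK σ 2 m = q₂ at *
  generalize φ 0 m = u
  generalize φ 1 m = v
  generalize φ 2 m = z
  -- The gap between the two sides as a sum of nonnegative terms: the `u`-`z` exchange, the cubic
  -- terms, Young's inequality for each forcing (with `a` joined to the `v`-forcing), and the bounds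
  -- `hq`.
  have key : 0 ≤ 2 * (P.α / P.k) * (P.k * u - P.β * z) ^ 2 + 2 * (u * (v - P.α * u)) ^ 2 +
      P.α / P.lam * (P.lam * u - q₀) ^ 2 +
      P.α * P.β / P.k / P.lam * (P.lam * z - q₂) ^ 2 +
      1 / P.lam * ((P.lam * v - (P.lam * P.a m + q₁)) ^ 2 + (P.lam * P.a m - q₁) ^ 2) +
      P.α / P.lam * (K ^ 2 * P.b 0 m ^ 2 - q₀ ^ 2) +
      2 / P.lam * (K ^ 2 * P.b 1 m ^ 2 - q₁ ^ 2) +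
      P.α * P.β / P.k / P.lam * (K ^ 2 * P.b 2 m ^ 2 - q₂ ^ 2) := by
    positivity
  rw [← sub_nonneg]
  refine key.trans (le_of_eq ?_)
  field_simp
  ring

/-- The energy inequality with a weight `η` on the sites. -/
theorem energy_le {P : GrayScott κ} (hP : P.Standing)
    (hK : ∀ i m σ, |P.f i m σ| ≤ K) {η : ℤ → ℝ} (hη0 : ∀ m, 0 ≤ η m) (hη1 : ∀ m, η m ≤ 1)
    (hη : ∀ m, |η m| ≤ 1) {δ : ℝ} (hδ0 : 0 ≤ δ) (hδ : ∀ m, η (m + 1) + η (m - 1) - 2 * η m ≤ δ)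
    (σ : Torus κ) (φ : PhaseSpace) :
    2 * inner ℝ (PhaseSpace.diag P.energyWeight η zero_le_one hη φ) (P.field hK0 hK σ φ) ≤
      -P.lam * inner ℝ (PhaseSpace.diag P.energyWeight η zero_le_one hη φ) φ +
        (∑' m, η m * P.energySource K m +
          δ * ((∑ i, P.energyWeight i * P.diffusion i) * ‖φ‖ ^ 2)) := by
  have hd : ∀ i, 0 ≤ P.diffusion i := fun i => by
    have h1 := hP.d₁_pos
    have h2 := hP.d₂_pos
    have h3 := hP.d₃_pos
    fin_cases i
    exacts [h1.le, h2.le, h3.le]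
  have hw : ∀ i, 0 ≤ P.energyWeight i := fun i => (energyWeight_pos hP i).le
  have hsum : ∀ u v : EllTwo, Summable fun m => η m * (u m * v m) := fun u v => by
    have := EllTwo.summable_mul (EllTwo.weight η zero_le_one hη u) v
    simpa [mul_assoc] using this
  set r : PhaseSpace := P.reaction φ + P.force hK0 hK σ with hr
  have hrm : ∀ i m, r i m = P.reaction φ i m + P.force hK0 hK σ i m := fun _ _ => rfl
  have hsrc : Summable fun m => η m * P.energySource K m :=
    Summable.of_nonneg_of_le (fun m => mul_nonneg (hη0 m) (energySource_nonneg hP K m))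
      (fun m => mul_le_of_le_one_left (energySource_nonneg hP K m) (hη1 m))
      (P.summable_energySource K)
  have hsplit : ∀ i, ∑' m, η m * (φ i m * P.field hK0 hK σ φ i m) =
      -P.diffusion i * ∑' m, η m * (φ i m * latticeA (φ i) m) + ∑' m, η m * (φ i m * r i m) := by
    intro i
    have hlap : Summable fun m => η m * (φ i m * latticeA (φ i) m) :=
      hsum (φ i) (EllTwo.lap (φ i))
    rw [← tsum_mul_left, ← (hlap.mul_left _).tsum_add (hsum (φ i) (r i))]
    refine tsum_congr fun m => ?_
    rw [field_apply, hrm]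
    ring
  have hreact : ∑ i, 2 * P.energyWeight i * ∑' m, η m * (φ i m * r i m) ≤
      -P.lam * (∑ i, P.energyWeight i * ∑' m, η m * (φ i m * φ i m)) +
        ∑' m, η m * P.energySource K m := by
    simp only [← tsum_mul_left]
    rw [← Summable.tsum_finsetSum fun i _ => (hsum (φ i) (r i)).mul_left _,
      ← Summable.tsum_finsetSum fun i _ => (hsum (φ i) (φ i)).mul_left _, ← tsum_mul_left,
      ← ((summable_sum fun i _ => (hsum (φ i) (φ i)).mul_left _).mul_left _).tsum_add hsrc]
    refine Summable.tsum_le_tsum (fun m => ?_)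
      (summable_sum fun i _ => (hsum (φ i) (r i)).mul_left _)
      (((summable_sum fun i _ => (hsum (φ i) (φ i)).mul_left _).mul_left _).add hsrc)
    have h := mul_le_mul_of_nonneg_left (reaction_energy_le hK0 hP hK σ φ m) (hη0 m)
    simp only [Fin.sum_univ_three, hrm] at h ⊢
    linarith
  -- Diffusion costs only the second differences of `η`, so nothing for constant `η`.
  have hdiff : ∑ i, P.energyWeight i * P.diffusion i *
      (-2 * ∑' m, η m * (φ i m * latticeA (φ i) m)) ≤
      δ * ((∑ i, P.energyWeight i * P.diffusion i) * ‖φ‖ ^ 2) := by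
    rw [Finset.sum_mul, Finset.mul_sum]
    refine Finset.sum_le_sum fun i _ => ?_
    have h1 := EllTwo.neg_two_mul_tsum_weight_lap_le hη0 hη1 hδ (φ i)
    have h2 : ‖φ i‖ ^ 2 ≤ ‖φ‖ ^ 2 :=
      pow_le_pow_left₀ (norm_nonneg _) (PhaseSpace.norm_apply_le φ i) 2
    have h3 := mul_le_mul_of_nonneg_left (h1.trans (mul_le_mul_of_nonneg_left h2 hδ0))
      (mul_nonneg (hw i) (hd i))
    linarith
  rw [PhaseSpace.inner_diag, PhaseSpace.inner_diag]
  simp only [hsplit]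
  simp only [Fin.sum_univ_three] at hreact hdiff ⊢
  linarith

end GrayScott

/-! ### The site cut-off for tail estimates -/

/-- The cut-off `min (|m| / n) 1` of the sites. -/
noncomputable def siteCutoff (n : ℕ) (m : ℤ) : ℝ := min (|(m : ℝ)| / n) 1

theorem siteCutoff_nonneg (n : ℕ) (m : ℤ) : 0 ≤ siteCutoff n m :=
  le_min (by positivity) zero_le_one

theorem siteCutoff_le_one (n : ℕ) (m : ℤ) : siteCutoff n m ≤ 1 := min_le_right _ _

theorem abs_siteCutoff_le_one (n : ℕ) (m : ℤ) : |siteCutoff n m| ≤ 1 := by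
  rw [abs_of_nonneg (siteCutoff_nonneg n m)]
  exact siteCutoff_le_one n m

theorem siteCutoff_eq_one {n : ℕ} (hn : 0 < n) {m : ℤ} (h : ¬|m| < (n : ℤ)) :
    siteCutoff n m = 1 := by
  have h1 : (n : ℝ) ≤ |(m : ℝ)| := by exact_mod_cast not_lt.1 h
  exact min_eq_right ((one_le_div (by exact_mod_cast hn)).2 h1)

theorem siteCutoff_sub_le (n : ℕ) (m j : ℤ) (hj : |(j : ℝ) - m| ≤ 1) :
    siteCutoff n j - siteCutoff n m ≤ 1 / n := by
  refine (le_abs_self _).trans ((abs_min_sub_min_le_max _ _ _ _).trans (max_le ?_ (by simp)))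
  rw [← sub_div, abs_div, Nat.abs_cast]
  exact div_le_div_of_nonneg_right ((abs_abs_sub_abs_le _ _).trans hj) n.cast_nonneg

/-- Two first differences of at most `1 / n` each. Only this upper bound matters; at the concave
corners `|m| = n` the second difference is negative anyway. -/
theorem siteCutoff_second_difference_le (n : ℕ) (m : ℤ) :
    siteCutoff n (m + 1) + siteCutoff n (m - 1) - 2 * siteCutoff n m ≤ 2 / n := by
  have h1 := siteCutoff_sub_le n m (m + 1) (by push_cast; simp)
  have h2 := siteCutoff_sub_le n m (m - 1) (by push_cast; simp)
  have h3 : (2 : ℝ) / n = 1 / n + 1 / n := by ring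
  linarith

theorem tendsto_siteCutoff (m : ℤ) : Tendsto (fun n => siteCutoff n m) atTop (𝓝 0) :=
  squeeze_zero (fun n => siteCutoff_nonneg n m) (fun _ => min_le_left _ _)
    (tendsto_const_div_atTop_nhds_zero_nat _)

/-- Dominated convergence: at each fixed site the cut-off tends to `0`, with `g` as the dominating
sequence. -/
theorem tendsto_tsum_siteCutoff {g : ℤ → ℝ} (hg : Summable g) (hg0 : ∀ m, 0 ≤ g m) :
    Tendsto (fun n => ∑' m, siteCutoff n m * g m) atTop (𝓝 0) := by
  have h := tendsto_tsum_of_dominated_convergence (f := fun n m => siteCutoff n m * g m)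
    (g := fun _ => 0) (𝓕 := atTop) hg (fun m => by simpa using (tendsto_siteCutoff m).mul_const (g m))
    (Eventually.of_forall fun n m => by
      rw [Real.norm_eq_abs, abs_of_nonneg (mul_nonneg (siteCutoff_nonneg n m) (hg0 m))]
      exact mul_le_of_le_one_left (hg0 m) (siteCutoff_le_one n m))
  simpa using h

/-! ### Well-posedness of the lattice system -/

namespace GrayScott

variable {κ : ℕ} {P : GrayScott κ} {K : ℝ}

theorem exists_le_energyWeight (hP : P.Standing) : ∃ c, 0 < c ∧ ∀ i, c ≤ P.energyWeight i := by
  obtain ⟨i, hi⟩ := Finite.exists_min P.energyWeight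
  exact ⟨_, energyWeight_pos hP i, hi⟩

/-- The energy with weights `η` on the sites controls the tails where `η = 1`. -/
theorem le_inner_diag {c : ℝ} (hc : 0 < c) (hcw : ∀ i, c ≤ P.energyWeight i) {η : ℤ → ℝ}
    (hη0 : ∀ m, 0 ≤ η m) (hη : ∀ m, |η m| ≤ 1) {N : ℕ} (hN : ∀ m : ℤ, ¬|m| < (N : ℤ) → η m = 1)
    (φ : PhaseSpace) : c * ‖φ - PhaseSpace.truncate N φ‖ ^ 2 ≤
      inner ℝ (PhaseSpace.diag P.energyWeight η zero_le_one hη φ) φ := by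
  rw [PhaseSpace.norm_sub_truncate_sq, PhaseSpace.inner_diag, Finset.mul_sum]
  refine Finset.sum_le_sum fun i _ => ?_
  have hs : Summable fun m => η m * (φ i m * φ i m) := by
    have := EllTwo.summable_mul (EllTwo.weight η zero_le_one hη (φ i)) (φ i)
    simpa [mul_assoc] using this
  refine mul_le_mul (hcw i) ?_ (tsum_nonneg fun m => ?_) (hc.le.trans (hcw i))
  · refine (PhaseSpace.summable_indicator_sq φ i N).tsum_le_tsum (fun m => ?_) hs
    split_ifs with h
    · exact mul_nonneg (hη0 m) (mul_self_nonneg _)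
    · rw [hN m h, one_mul, sq]
  · split_ifs
    exacts [le_rfl, sq_nonneg _]

/-- The case `N = 0` of the tail bound, where the tail is all of `φ`. -/
theorem le_inner_diag_one {c : ℝ} (hc : 0 < c) (hcw : ∀ i, c ≤ P.energyWeight i)
    (hη : ∀ _ : ℤ, |(1 : ℝ)| ≤ 1) (φ : PhaseSpace) : c * ‖φ‖ ^ 2 ≤
      inner ℝ (PhaseSpace.diag P.energyWeight (fun _ => 1) zero_le_one hη φ) φ := by
  have h := le_inner_diag hc hcw (fun _ => zero_le_one) hη (N := 0) (fun _ _ => rfl) φ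
  have h0 : PhaseSpace.truncate 0 φ = 0 := by
    ext i m
    rw [PhaseSpace.truncate, PhaseSpace.diag_apply]
    simp [not_lt.2 (abs_nonneg m)]
  rwa [h0, sub_zero] at h

theorem isSolution_iff (hK0 : 0 ≤ K) (hK : ∀ i m σ, |P.f i m σ| ≤ K) {σ : Torus κ}
    {φ₀ : PhaseSpace} {φ : ℝ → PhaseSpace} : P.IsSolution σ φ₀ φ ↔
      φ 0 = φ₀ ∧ ContinuousOn φ (Set.Ici 0) ∧
        ∀ t, 0 < t → HasDerivAt φ (P.field hK0 hK (P.θ t σ) (φ t)) t := by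
  constructor
  · rintro ⟨h1, h2, h3⟩
    refine ⟨h2, h1, fun t ht => ?_⟩
    obtain ⟨φ', hφ', he⟩ := h3 t ht
    have : φ' = P.field hK0 hK (P.θ t σ) (φ t) := by
      ext i m
      rw [he, field_apply_eq_rhs]
    rwa [← this]
  · rintro ⟨h1, h2, h3⟩
    exact ⟨h2, h1, fun t ht => ⟨_, h3 t ht, fun i m => P.field_apply_eq_rhs hK0 hK _ _ i m⟩⟩

theorem exists_lipschitz_field (hK0 : 0 ≤ K) (hK : ∀ i m σ, |P.f i m σ| ≤ K) (R : ℝ) :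
    ∃ L, 0 ≤ L ∧ ∀ σ, ∀ x y : PhaseSpace, ‖x‖ ≤ R → ‖y‖ ≤ R →
      ‖P.field hK0 hK σ x - P.field hK0 hK σ y‖ ≤ L * ‖x - y‖ := by
  obtain ⟨L, hL, h⟩ := P.lipschitzOnBalls_field hK0 hK 0 R
  refine ⟨L, hL, fun σ x y hx hy => ?_⟩
  rw [field_sub, sub_self, add_zero]
  exact h x y hx hy

theorem exists_lipschitz_field_symbol (hK0 : 0 ≤ K) (hK : ∀ i m σ, |P.f i m σ| ≤ K) (h2 : P.H2) :
    ∃ C, 0 ≤ C ∧ ∀ R, ∃ L, 0 ≤ L ∧ ∀ σ τ, ∀ x y : PhaseSpace, ‖x‖ ≤ R → ‖y‖ ≤ R →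
      ‖P.field hK0 hK σ x - P.field hK0 hK τ y‖ ≤ L * ‖x - y‖ + C * ‖σ - τ‖ := by
  obtain ⟨C, hC, hf⟩ := h2.exists_norm_force_sub_le hK0 hK
  refine ⟨C, hC, fun R => ?_⟩
  obtain ⟨L, hL, h⟩ := P.lipschitzOnBalls_field hK0 hK 0 R
  refine ⟨L, hL, fun σ τ x y hx hy => ?_⟩
  rw [field_sub]
  exact (norm_add_le _ _).trans (add_le_add (h x y hx hy) (hf σ τ))

theorem exists_isSolution (hP : P.Standing) (h2 : P.H2) (σ : Torus κ) (φ₀ : PhaseSpace) :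
    ∃ φ, P.IsSolution σ φ₀ φ := by
  obtain ⟨K, hK0, hK⟩ := h2.exists_bound
  obtain ⟨C, hC, hlip⟩ := exists_lipschitz_field_symbol hK0 hK h2
  obtain ⟨Cσ, hCσ, hσ⟩ := Torus.exists_norm_le κ
  obtain ⟨c, hc, hcw⟩ := exists_le_energyWeight hP
  have h1 : ∀ _ : ℤ, |(1 : ℝ)| ≤ 1 := fun _ => by simp
  have hcont : ∀ x, Continuous fun t => P.field hK0 hK (P.θ t σ) x := by
    intro x
    obtain ⟨L, -, h⟩ := hlip ‖x‖
    have hL : LipschitzWith ⟨C, hC⟩ fun τ => P.field hK0 hK τ x :=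
      LipschitzWith.of_dist_le_mul fun τ₁ τ₂ => by
        rw [dist_eq_norm, dist_eq_norm]
        have h' := h τ₁ τ₂ x x le_rfl le_rfl
        rw [sub_self, norm_zero, mul_zero, zero_add] at h'
        exact h'
    exact hL.continuous.comp (P.continuous_θ_left σ)
  have hlipF : ∀ R : ℝ, ∃ L, 0 ≤ L ∧ ∀ t, ∀ x y : PhaseSpace, ‖x‖ ≤ R → ‖y‖ ≤ R →
      ‖P.field hK0 hK (P.θ t σ) x - P.field hK0 hK (P.θ t σ) y‖ ≤ L * ‖x - y‖ := by
    intro R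
    obtain ⟨L, hL, h⟩ := exists_lipschitz_field hK0 hK R
    exact ⟨L, hL, fun t => h _⟩
  have hbdd : ∀ R : ℝ, ∃ M, 0 ≤ M ∧ ∀ t, ∀ x : PhaseSpace, ‖x‖ ≤ R →
      ‖P.field hK0 hK (P.θ t σ) x‖ ≤ M := by
    intro R
    obtain ⟨L, hL, h⟩ := hlip R
    obtain ⟨M, hM, hb⟩ := (P.lipschitzOnBalls_field hK0 hK 0).exists_bound R
    refine ⟨M + C * Cσ, by positivity, fun t x hx => ?_⟩
    have e1 := h (P.θ t σ) 0 x x hx hx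
    rw [sub_self, norm_zero, mul_zero, zero_add, sub_zero] at e1
    have e2 : ‖P.field hK0 hK (P.θ t σ) x‖ ≤ ‖P.field hK0 hK 0 x‖ +
        ‖P.field hK0 hK (P.θ t σ) x - P.field hK0 hK 0 x‖ := norm_le_norm_add_norm_sub' _ _
    have e3 : C * ‖P.θ t σ‖ ≤ C * Cσ := mul_le_mul_of_nonneg_left (hσ _) hC
    have e4 := hb x hx
    linarith
  have henergy : ∀ t x, 2 * inner ℝ (PhaseSpace.diag P.energyWeight (fun _ => 1) zero_le_one h1 x)
      (P.field hK0 hK (P.θ t σ) x) ≤ ∑' m, P.energySource K m := by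
    intro t x
    have h := energy_le hK0 hP hK (η := fun _ => 1) (fun _ => zero_le_one) (fun _ => le_rfl) h1
      le_rfl (δ := 0) (fun _ => by norm_num) (P.θ t σ) x
    have hpos := le_inner_diag_one hc hcw h1 x
    have hpos' : 0 ≤ c * ‖x‖ ^ 2 := by positivity
    have hl := mul_nonneg hP.lam_pos.le (hpos'.trans hpos)
    simp only [one_mul, zero_mul, add_zero] at h
    linarith
  obtain ⟨φ, h0, hφc, hφd⟩ := exists_global_solution_of_energy hcont hlipF hbdd
    (PhaseSpace.inner_diag_symm P.energyWeight (fun _ => 1) zero_le_one h1) hc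
    (le_inner_diag_one hc hcw h1) (tsum_nonneg (energySource_nonneg hP K)) henergy φ₀
  exact ⟨φ, (isSolution_iff hK0 hK).2 ⟨h0, hφc, hφd⟩⟩

theorem exists_isSolutionFamily (hP : P.Standing) (h2 : P.H2) :
    ∃ U : ℝ → Torus κ → PhaseSpace → PhaseSpace, P.IsSolutionFamily U := by
  choose S hS using exists_isSolution hP h2
  refine ⟨fun t σ φ₀ => S σ φ₀ t, hS, fun σ φ₀ ψ hψ t ht => ?_⟩
  obtain ⟨K, hK0, hK⟩ := h2.exists_bound
  obtain ⟨h1, h2, h3⟩ := (isSolution_iff hK0 hK).1 hψ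
  obtain ⟨h1', h2', h3'⟩ := (isSolution_iff hK0 hK).1 (hS σ φ₀)
  refine eqOn_of_solutions (F := fun t x => P.field hK0 hK (P.θ t σ) x) (T := t) (fun R => ?_)
    (h2.mono Set.Icc_subset_Ici_self) (h2'.mono Set.Icc_subset_Ici_self)
    (fun s hs => h3 s hs.1) (fun s hs => h3' s hs.1) (h1.trans h1'.symm) ⟨ht, le_rfl⟩
  obtain ⟨L, hL, h⟩ := exists_lipschitz_field hK0 hK R
  exact ⟨L, hL, fun t => h _⟩

theorem tendsto_exp_decay (hP : P.Standing) (A : ℝ) :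
    Tendsto (fun t => Real.exp (-(P.lam * t)) * A) atTop (𝓝 0) := by
  have h1 : Tendsto (fun t => Real.exp (-(P.lam * t))) atTop (𝓝 0) :=
    Real.tendsto_exp_neg_atTop_nhds_zero.comp (tendsto_id.const_mul_atTop hP.lam_pos)
  simpa using h1.mul_const A

/-! ### Absorption, tail estimates and continuity of the solution operators -/

namespace IsSolutionFamily

variable {U : ℝ → Torus κ → PhaseSpace → PhaseSpace}

/-- Uniqueness: the orbit restarted at time `t` solves the problem with symbol `θ_t σ`. -/
theorem add_apply (hU : P.IsSolutionFamily U) {s t : ℝ} (hs : 0 ≤ s) (ht : 0 ≤ t)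
    (σ : Torus κ) (φ : PhaseSpace) : U (s + t) σ φ = U s (P.θ t σ) (U t σ φ) := by
  obtain ⟨h1, h2, h3⟩ := hU.isSolution σ φ
  refine hU.unique (P.θ t σ) (U t σ φ) (fun s => U (s + t) σ φ) ⟨?_, by simp, fun r hr => ?_⟩ s hs
  · exact h1.comp (by fun_prop : Continuous fun s : ℝ => s + t).continuousOn
      fun r hr => add_nonneg (Set.mem_Ici.1 hr) ht
  · obtain ⟨φ', hφ', he⟩ := h3 (r + t) (by linarith)
    refine ⟨φ', hφ'.comp_add_const r t, fun i m => ?_⟩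
    rw [he, θ_add]

/-- The weighted energy inequality along solutions that stay in a ball. -/
theorem energy_le_exp (hU : P.IsSolutionFamily U) (hP : P.Standing) (hK0 : 0 ≤ K)
    (hK : ∀ i m σ, |P.f i m σ| ≤ K) {η : ℤ → ℝ} (hη0 : ∀ m, 0 ≤ η m)
    (hη1 : ∀ m, η m ≤ 1) (hη : ∀ m, |η m| ≤ 1) {δ : ℝ} (hδ0 : 0 ≤ δ)
    (hδ : ∀ m, η (m + 1) + η (m - 1) - 2 * η m ≤ δ) {S : ℝ} (σ : Torus κ)
    (φ : PhaseSpace) {t : ℝ} (ht : 0 ≤ t)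
    (hS : ∀ s ∈ Set.Ioo 0 t,
      δ * ((∑ i, P.energyWeight i * P.diffusion i) * ‖U s σ φ‖ ^ 2) ≤ S) :
    inner ℝ (PhaseSpace.diag P.energyWeight η zero_le_one hη (U t σ φ)) (U t σ φ) ≤
      (∑' m, η m * P.energySource K m + S) / P.lam + Real.exp (-(P.lam * t)) *
        (inner ℝ (PhaseSpace.diag P.energyWeight η zero_le_one hη φ) φ -
          (∑' m, η m * P.energySource K m + S) / P.lam) := by
  obtain ⟨h1, h2, h3⟩ := (isSolution_iff hK0 hK).1 (hU.isSolution σ φ)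
  have hl := hP.lam_pos
  set D := PhaseSpace.diag P.energyWeight η zero_le_one hη with hD
  have hcont : ContinuousOn (fun s => U s σ φ) (Set.Icc 0 t) := h2.mono Set.Icc_subset_Ici_self
  have h := le_exp_of_deriv_le (T := t) (g := fun s => inner ℝ (D (U s σ φ)) (U s σ φ))
    (c := P.lam) (K := (∑' m, η m * P.energySource K m + S) / P.lam)
    (ContinuousOn.inner (𝕜 := ℝ) (D.continuous.comp_continuousOn hcont) hcont)
    (fun s hs => hasDerivAt_inner_symm
      (PhaseSpace.inner_diag_symm P.energyWeight η zero_le_one hη) (h3 s hs.1))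
    (fun s hs => ?_) ⟨ht, le_rfl⟩
  · rwa [h1] at h
  · have e1 := energy_le hK0 hP hK hη0 hη1 hη hδ0 hδ (P.θ s σ) (U s σ φ)
    have e2 := hS s hs
    have e3 : P.lam * ((∑' m, η m * P.energySource K m + S) / P.lam) =
        ∑' m, η m * P.energySource K m + S := mul_div_cancel₀ _ hl.ne'
    rw [mul_sub, e3]
    linarith

/-- The energy inequality with constant site weight. The constants do not depend on the symbol,
which makes absorption uniform. -/
theorem norm_sq_le_exp (hU : P.IsSolutionFamily U) (hP : P.Standing) (h2 : P.H2) :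
    ∃ c G M : ℝ, 0 < c ∧ 0 ≤ G ∧ 0 ≤ M ∧ ∀ t, 0 ≤ t → ∀ σ φ,
      c * ‖U t σ φ‖ ^ 2 ≤ G + Real.exp (-(P.lam * t)) * (M * ‖φ‖ ^ 2) := by
  obtain ⟨K, hK0, hK⟩ := h2.exists_bound
  obtain ⟨c, hc, hcw⟩ := exists_le_energyWeight hP
  have hη : ∀ _ : ℤ, |(1 : ℝ)| ≤ 1 := fun _ => by simp
  set D := PhaseSpace.diag P.energyWeight (fun _ => 1) zero_le_one hη with hD
  have hG : 0 ≤ (∑' m, P.energySource K m) / P.lam :=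
    div_nonneg (tsum_nonneg (energySource_nonneg hP K)) hP.lam_pos.le
  refine ⟨c, (∑' m, P.energySource K m) / P.lam, ‖D‖, hc, hG, norm_nonneg _, fun t ht σ φ => ?_⟩
  have h := hU.energy_le_exp hP hK0 hK (η := fun _ => 1) (fun _ => zero_le_one) (fun _ => le_rfl)
    hη le_rfl (δ := 0) (fun _ => by norm_num) (S := 0) σ φ ht (fun _ _ => by simp)
  simp only [one_mul, add_zero] at h
  have h3 := le_inner_diag_one hc hcw hη (U t σ φ)
  have h4 : inner ℝ (D φ) φ ≤ ‖D‖ * ‖φ‖ ^ 2 := by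
    refine (real_inner_le_norm _ _).trans ?_
    rw [sq, ← mul_assoc]
    exact mul_le_mul_of_nonneg_right (D.le_opNorm φ) (norm_nonneg _)
  have h5 := Real.exp_pos (-(P.lam * t))
  refine h3.trans (h.trans ?_)
  have h6 := mul_le_mul_of_nonneg_left h4 h5.le
  have h7 := mul_nonneg h5.le hG
  linarith

theorem exists_norm_le (hU : P.IsSolutionFamily U) (hP : P.Standing) (h2 : P.H2) (R : ℝ) :
    ∃ R', 0 ≤ R' ∧ ∀ t, 0 ≤ t → ∀ σ φ, ‖φ‖ ≤ R → ‖U t σ φ‖ ≤ R' := by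
  obtain ⟨c, G, M, hc, hG, hM, h⟩ := hU.norm_sq_le_exp hP h2
  refine ⟨Real.sqrt ((G + M * R ^ 2) / c), Real.sqrt_nonneg _, fun t ht σ φ hφ => ?_⟩
  refine Real.le_sqrt_of_sq_le ?_
  rw [le_div_iff₀ hc, mul_comm]
  refine (h t ht σ φ).trans ?_
  have h1 : Real.exp (-(P.lam * t)) ≤ 1 :=
    Real.exp_le_one_iff.2 (neg_nonpos.2 (mul_nonneg hP.lam_pos.le ht))
  have h3 : M * ‖φ‖ ^ 2 ≤ M * R ^ 2 :=
    mul_le_mul_of_nonneg_left (pow_le_pow_left₀ (norm_nonneg _) hφ 2) hM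
  have h4 := mul_le_of_le_one_left (mul_nonneg hM (sq_nonneg ‖φ‖)) h1
  linarith

/-- There is a ball that absorbs every bounded set, uniformly in the symbol. -/
theorem exists_absorbing (hU : P.IsSolutionFamily U) (hP : P.Standing) (h2 : P.H2) :
    ∃ R₀ : ℝ, 0 ≤ R₀ ∧ ∀ R, ∃ T, 0 ≤ T ∧ ∀ t, T ≤ t → ∀ σ φ, ‖φ‖ ≤ R → ‖U t σ φ‖ ≤ R₀ := by
  obtain ⟨c, G, M, hc, hG, hM, h⟩ := hU.norm_sq_le_exp hP h2
  refine ⟨Real.sqrt ((G + 1) / c), Real.sqrt_nonneg _, fun R => ?_⟩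
  obtain ⟨T, hT⟩ := (((tendsto_exp_decay hP (M * R ^ 2)).eventually_le_const
    one_pos).and (eventually_ge_atTop 0)).exists_forall_of_atTop
  refine ⟨T, (hT T le_rfl).2, fun t ht σ φ hφ => ?_⟩
  obtain ⟨hT1, hT0⟩ := hT t ht
  refine Real.le_sqrt_of_sq_le ?_
  rw [le_div_iff₀ hc, mul_comm]
  refine (h t hT0 σ φ).trans ?_
  have h3 : M * ‖φ‖ ^ 2 ≤ M * R ^ 2 :=
    mul_le_mul_of_nonneg_left (pow_le_pow_left₀ (norm_nonneg _) hφ 2) hM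
  have h4 := mul_le_mul_of_nonneg_left h3 (Real.exp_pos (-(P.lam * t))).le
  linarith

/-- The tails of the solutions are eventually small, uniformly on bounded sets of initial values
and in the symbol. -/
theorem exists_tail_le (hU : P.IsSolutionFamily U) (hP : P.Standing) (h2 : P.H2) (R : ℝ)
    {ε : ℝ} (hε : 0 < ε) :
    ∃ T, 0 ≤ T ∧ ∃ N, ∀ t, T ≤ t → ∀ σ φ, ‖φ‖ ≤ R →
      ‖U t σ φ - PhaseSpace.truncate N (U t σ φ)‖ < ε := by
  obtain ⟨K, hK0, hK⟩ := h2.exists_bound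
  obtain ⟨c, hc, hcw⟩ := exists_le_energyWeight hP
  obtain ⟨R', hR', hbd⟩ := hU.exists_norm_le hP h2 R
  have hl := hP.lam_pos
  set W := ∑ i, P.energyWeight i * P.diffusion i with hW
  have hW0 : 0 ≤ W := by
    refine Finset.sum_nonneg fun i _ => mul_nonneg (energyWeight_pos hP i).le ?_
    have h1 := hP.d₁_pos
    have h2 := hP.d₂_pos
    have h3 := hP.d₃_pos
    fin_cases i
    exacts [h1.le, h2.le, h3.le]
  have hlim : Tendsto (fun n : ℕ => (∑' m, siteCutoff n m * P.energySource K m +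
      2 / n * (W * R' ^ 2)) / P.lam) atTop (𝓝 0) := by
    have := ((tendsto_tsum_siteCutoff (P.summable_energySource K)
      (energySource_nonneg hP K)).add
      ((tendsto_const_div_atTop_nhds_zero_nat 2).mul_const (W * R' ^ 2))).div_const P.lam
    simpa using this
  have hcε : 0 < c * ε ^ 2 / 2 := by positivity
  -- Half of `c * ε ^ 2` goes to the limiting level of the weighted energy, made small by `n`; the
  -- other half to the decaying initial energy, made small by `T` once `n` is fixed.
  obtain ⟨n, hn, hn0⟩ := ((hlim.eventually_lt_const hcε).and (eventually_gt_atTop 0)).exists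
  set D := PhaseSpace.diag P.energyWeight (siteCutoff n) zero_le_one (abs_siteCutoff_le_one n)
    with hD
  obtain ⟨T, hT⟩ := (((tendsto_exp_decay hP (‖D‖ * R ^ 2)).eventually_lt_const
    hcε).and (eventually_ge_atTop 0)).exists_forall_of_atTop
  refine ⟨T, (hT T le_rfl).2, n, fun t ht σ φ hφ => ?_⟩
  obtain ⟨hT1, hT0⟩ := hT t ht
  have h := hU.energy_le_exp hP hK0 hK (siteCutoff_nonneg n) (siteCutoff_le_one n)
    (abs_siteCutoff_le_one n) (δ := 2 / n) (by positivity) (siteCutoff_second_difference_le n)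
    (S := 2 / n * (W * R' ^ 2)) σ φ hT0 (fun s hs => by
      have := hbd s hs.1.le σ φ hφ
      gcongr)
  have h3 := le_inner_diag hc hcw (siteCutoff_nonneg n) (abs_siteCutoff_le_one n) (N := n)
    (fun m hm => siteCutoff_eq_one hn0 hm) (U t σ φ)
  have h4 : inner ℝ (D φ) φ ≤ ‖D‖ * R ^ 2 := by
    refine (real_inner_le_norm _ _).trans ?_
    rw [sq, ← mul_assoc]
    exact mul_le_mul ((D.le_opNorm φ).trans (mul_le_mul_of_nonneg_left hφ (norm_nonneg _))) hφ
      (norm_nonneg _) (mul_nonneg (norm_nonneg _) ((norm_nonneg _).trans hφ))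
  have h5 := Real.exp_pos (-(P.lam * t))
  have h6 := mul_le_mul_of_nonneg_left h4 h5.le
  have h7 : 0 ≤ (∑' m, siteCutoff n m * P.energySource K m + 2 / n * (W * R' ^ 2)) / P.lam := by
    refine div_nonneg (add_nonneg (tsum_nonneg fun m => ?_) (by positivity)) hl.le
    exact mul_nonneg (siteCutoff_nonneg n m) (energySource_nonneg hP K m)
  have h8 := mul_nonneg h5.le h7
  have h9 : c * ‖U t σ φ - PhaseSpace.truncate n (U t σ φ)‖ ^ 2 < c * ε ^ 2 := by
    linarith
  exact lt_of_pow_lt_pow_left₀ 2 hε.le (lt_of_mul_lt_mul_left h9 hc.le)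

/-- Continuous dependence on the initial value and the symbol. -/
theorem continuous_uncurry (hU : P.IsSolutionFamily U) (hP : P.Standing) (h2 : P.H2)
    {t : ℝ} (ht : 0 ≤ t) :
    Continuous fun p : ExtendedSpace κ => U t p.snd p.fst := by
  obtain ⟨K, hK0, hK⟩ := h2.exists_bound
  obtain ⟨C, hC, hlip⟩ := exists_lipschitz_field_symbol hK0 hK h2
  rw [continuous_iff_continuousAt]
  intro q
  obtain ⟨R, hR, hbd⟩ := hU.exists_norm_le hP h2 (‖q.fst‖ + 1)
  obtain ⟨L, hL, hlip⟩ := hlip R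
  have hfst : Continuous fun p : ExtendedSpace κ => p.fst := WithLp.continuous_fst 2 _ _
  have hsnd : Continuous fun p : ExtendedSpace κ => p.snd := WithLp.continuous_snd 2 _ _
  have key : ∀ᶠ p : ExtendedSpace κ in 𝓝 q, ‖U t p.snd p.fst - U t q.snd q.fst‖ ^ 2 ≤
      Real.exp ((2 * L + 1) * t) *
        (‖p.fst - q.fst‖ ^ 2 + (C * ‖p.snd - q.snd‖) ^ 2) := by
    have hball : ∀ᶠ p : ExtendedSpace κ in 𝓝 q, ‖p.fst‖ ≤ ‖q.fst‖ + 1 :=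
      (hfst.norm.tendsto q).eventually_le_const (lt_add_one _)
    filter_upwards [hball] with p hp
    obtain ⟨h1, h2, h3⟩ := (isSolution_iff hK0 hK).1 (hU.isSolution p.snd p.fst)
    obtain ⟨h1', h2', h3'⟩ := (isSolution_iff hK0 hK).1 (hU.isSolution q.snd q.fst)
    -- `δ` does not depend on time because `θ_s` preserves differences of symbols.
    have h := norm_sub_sq_le_of_solutions (T := t) (δ := C * ‖p.snd - q.snd‖) hL
      (F := fun s => P.field hK0 hK (P.θ s p.snd)) (G := fun s => P.field hK0 hK (P.θ s q.snd))
      (R := R) (fun s x y hx hy => by simpa using hlip (P.θ s p.snd) (P.θ s q.snd) x y hx hy)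
      (h2.mono Set.Icc_subset_Ici_self) (h2'.mono Set.Icc_subset_Ici_self)
      (fun s hs => h3 s hs.1) (fun s hs => h3' s hs.1)
      (fun s hs => hbd s hs.1.le _ _ hp) (fun s hs => hbd s hs.1.le _ _ (by linarith))
      ⟨ht, le_rfl⟩
    rwa [h1, h1'] at h
  have hlim : Tendsto (fun p : ExtendedSpace κ => Real.exp ((2 * L + 1) * t) *
      (‖p.fst - q.fst‖ ^ 2 + (C * ‖p.snd - q.snd‖) ^ 2)) (𝓝 q) (𝓝 0) := by
    have hc : Continuous fun p : ExtendedSpace κ => Real.exp ((2 * L + 1) * t) *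
      (‖p.fst - q.fst‖ ^ 2 + (C * ‖p.snd - q.snd‖) ^ 2) := by fun_prop
    simpa using hc.tendsto q
  have hsq : Tendsto (fun p : ExtendedSpace κ => ‖U t p.snd p.fst - U t q.snd q.fst‖ ^ 2)
      (𝓝 q) (𝓝 0) :=
    squeeze_zero' (Eventually.of_forall fun _ => sq_nonneg _) key hlim
  have hn : Tendsto (fun p : ExtendedSpace κ => ‖U t p.snd p.fst - U t q.snd q.fst‖)
      (𝓝 q) (𝓝 0) := by
    simpa [Real.sqrt_sq] using hsq.sqrt
  exact tendsto_iff_norm_sub_tendsto_zero.2 hn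

end IsSolutionFamily

end GrayScott

/-! ### The skew-product flow and its attractors -/

theorem ExtendedSpace.dist_le_add {κ : ℕ} (p q : ExtendedSpace κ) :
    dist p q ≤ dist p.fst q.fst + dist p.snd q.snd := by
  rw [dist_eq_norm, dist_eq_norm, dist_eq_norm]
  refine le_of_sq_le_sq ?_ (by positivity)
  rw [WithLp.prod_norm_sq_eq_of_L2, WithLp.sub_fst, WithLp.sub_snd]
  nlinarith [norm_nonneg (p.fst - q.fst), norm_nonneg (p.snd - q.snd),
    mul_nonneg (norm_nonneg (p.fst - q.fst)) (norm_nonneg (p.snd - q.snd))]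

namespace GrayScott

variable {κ : ℕ} {P : GrayScott κ} {U : ℝ → Torus κ → PhaseSpace → PhaseSpace}

/-- The cylinder over the ball of radius `R` in the extended space. -/
def cylinder (κ : ℕ) (R : ℝ) : Set (ExtendedSpace κ) := {p | ‖p.fst‖ ≤ R}

theorem mem_cylinder {R : ℝ} {p : ExtendedSpace κ} : p ∈ cylinder κ R ↔ ‖p.fst‖ ≤ R := Iff.rfl

theorem exists_subset_cylinder {D : Set (ExtendedSpace κ)} (hD : Bornology.IsBounded D) :
    ∃ R, D ⊆ cylinder κ R := by
  obtain ⟨R, hR⟩ := hD.exists_norm_le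
  exact ⟨R, fun p hp => (WithLp.norm_fst_le _ p).trans (hR p hp)⟩

theorem isBounded_cylinder (R : ℝ) : Bornology.IsBounded (cylinder κ R) := by
  obtain ⟨C, hC, hσ⟩ := Torus.exists_norm_le κ
  refine isBounded_iff_forall_norm_le.2 ⟨R + C, fun p hp => ?_⟩
  have h := ExtendedSpace.dist_le_add p 0
  simp only [dist_zero_right, WithLp.zero_fst, WithLp.zero_snd] at h
  exact h.trans (add_le_add hp (hσ _))

@[simp] theorem skewProduct_fst (t : ℝ) (p : ExtendedSpace κ) :
    (P.skewProduct U t p).fst = U t p.snd p.fst := rfl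

@[simp] theorem skewProduct_snd (t : ℝ) (p : ExtendedSpace κ) :
    (P.skewProduct U t p).snd = P.θ t p.snd := rfl

theorem continuous_θ_right (t : ℝ) : Continuous (P.θ t) :=
  (LipschitzWith.of_dist_le_mul (K := 1) fun σ τ => by
    rw [dist_eq_norm, dist_eq_norm, θ_sub, NNReal.coe_one, one_mul]).continuous

namespace IsSolutionFamily

theorem skewProduct_add (hU : P.IsSolutionFamily U) {s t : ℝ} (hs : 0 ≤ s) (ht : 0 ≤ t)
    (p : ExtendedSpace κ) :
    P.skewProduct U (s + t) p = P.skewProduct U s (P.skewProduct U t p) := by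
  rw [skewProduct, skewProduct, hU.add_apply hs ht, θ_add]
  rfl

theorem continuous_skewProduct (hU : P.IsSolutionFamily U) (hP : P.Standing) (h2 : P.H2) {t : ℝ}
    (ht : 0 ≤ t) : Continuous (P.skewProduct U t) := by
  refine (WithLp.prod_continuous_toLp 2 _ _).comp ((hU.continuous_uncurry hP h2 ht).prodMk ?_)
  exact (continuous_θ_right t).comp (WithLp.continuous_snd 2 _ _)

theorem asymptoticallyCompactOn_skewProduct (hU : P.IsSolutionFamily U) (hP : P.Standing)
    (h2 : P.H2) (R : ℝ) : AsymptoticallyCompactOn (P.skewProduct U) (cylinder κ R) := by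
  refine asymptoticallyCompactOn_of_cover fun ε hε => ?_
  -- One third each for the tail, the net of truncations and the net of the torus.
  have hε3 : 0 < ε / 3 := by positivity
  obtain ⟨R', hR', hbd⟩ := hU.exists_norm_le hP h2 R
  obtain ⟨T, hT0, N, hT⟩ := hU.exists_tail_le hP h2 R hε3
  obtain ⟨F, hF, hFc⟩ := Metric.totallyBounded_iff.1 (PhaseSpace.totallyBounded_truncate N R')
    (ε / 3) hε3
  obtain ⟨G, hG, hGc⟩ := Metric.totallyBounded_iff.1 (isCompact_univ (X := Torus κ)).totallyBounded
    (ε / 3) hε3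
  refine ⟨T, (fun p : PhaseSpace × Torus κ => (WithLp.toLp 2 p : ExtendedSpace κ)) '' (F ×ˢ G),
    (hF.prod hG).image _, fun t ht p hp => ?_⟩
  have h1 := hT t ht p.snd p.fst hp
  have hmem : PhaseSpace.truncate N (U t p.snd p.fst) ∈
      PhaseSpace.truncate N '' Metric.closedBall 0 R' :=
    ⟨_, mem_closedBall_zero_iff.2 (hbd t (hT0.trans ht) p.snd p.fst hp), rfl⟩
  obtain ⟨φ, hφ, hφd⟩ := Set.mem_iUnion₂.1 (hFc hmem)
  obtain ⟨σ, hσ, hσd⟩ := Set.mem_iUnion₂.1 (hGc (Set.mem_univ (P.θ t p.snd)))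
  refine ⟨_, ⟨(φ, σ), ⟨hφ, hσ⟩, rfl⟩, ?_⟩
  have h3 := ExtendedSpace.dist_le_add (P.skewProduct U t p) (WithLp.toLp 2 (φ, σ))
  have h4 := dist_triangle (U t p.snd p.fst) (PhaseSpace.truncate N (U t p.snd p.fst)) φ
  rw [← dist_eq_norm] at h1
  rw [Metric.mem_ball] at hφd hσd
  simp only [skewProduct_fst, skewProduct_snd, WithLp.toLp_fst, WithLp.toLp_snd] at h3
  linarith

/-- The skew-product flow has a global attractor. -/
theorem exists_isGlobalAttractor (hU : P.IsSolutionFamily U) (hP : P.Standing) (h2 : P.H2) :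
    ∃ A : Torus κ → Set PhaseSpace, IsGlobalAttractor (P.skewProduct U) (bundle A) := by
  obtain ⟨R₀, -, habs⟩ := hU.exists_absorbing hP h2
  refine ⟨fun σ => {φ | (WithLp.toLp 2 (φ, σ) : ExtendedSpace κ) ∈
    limitPoints (P.skewProduct U) (cylinder κ R₀)}, ?_⟩
  refine isGlobalAttractor_limitPoints (fun s t p hs ht => hU.skewProduct_add hs ht p)
    (fun t ht => hU.continuous_skewProduct hP h2 ht) (fun D hD => ?_)
    (hU.asymptoticallyCompactOn_skewProduct hP h2 R₀)
  obtain ⟨R, hR⟩ := exists_subset_cylinder hD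
  obtain ⟨T, hT, h⟩ := habs R
  refine ⟨T, hT, fun t ht => ?_⟩
  rintro _ ⟨p, hp, rfl⟩
  exact h t ht p.snd p.fst (hR hp)

/-- A bound for the attractor, as a ball in the phase space. -/
theorem exists_attractor_bound {A : Torus κ → Set PhaseSpace} 
    {Ψ : ℝ → ExtendedSpace κ → ExtendedSpace κ} (hA : IsGlobalAttractor Ψ (bundle A)) :
    ∃ R, ∀ σ, ∀ φ ∈ A σ, ‖φ‖ ≤ R := by
  obtain ⟨R, hR⟩ := exists_subset_cylinder hA.isCompact.isBounded
  refine ⟨R, fun σ φ hφ => ?_⟩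
  have h : (WithLp.toLp 2 (φ, σ) : ExtendedSpace κ) ∈ bundle A := hφ
  simpa only [mem_cylinder, WithLp.toLp_fst] using hR h

/-- Invariance of the bundle read fibrewise; `θ_t` is injective, so a preimage of a point over `θ_t
σ` lies over `σ`. -/
theorem image_section_eq {A : Torus κ → Set PhaseSpace}
    (hA : IsGlobalAttractor (P.skewProduct U) (bundle A)) (σ : Torus κ) {t : ℝ} (ht : 0 ≤ t) :
    U t σ '' A σ = A (P.θ t σ) := by
  refine Set.Subset.antisymm ?_ fun ψ hψ => ?_
  · rintro _ ⟨φ, hφ, rfl⟩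
    have h : P.skewProduct U t (WithLp.toLp 2 (φ, σ)) ∈ bundle A := by
      rw [← hA.invariant t ht]
      exact ⟨_, hφ, rfl⟩
    exact h
  · have h : (WithLp.toLp 2 (ψ, P.θ t σ) : ExtendedSpace κ) ∈ bundle A := hψ
    rw [← hA.invariant t ht] at h
    obtain ⟨p, hp, he⟩ := h
    have h1 : P.θ t p.snd = P.θ t σ := congrArg WithLp.snd he
    have h2 : U t p.snd p.fst = ψ := congrArg WithLp.fst he
    have h3 : p.snd = σ := by rw [← P.θ_neg_θ t p.snd, h1, θ_neg_θ]
    rw [← h2, h3]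
    refine ⟨p.fst, ?_, rfl⟩
    rw [← h3]
    exact hp

/-- The sections of the global attractor of the skew-product flow form the pullback attractor. -/
theorem isPullbackAttractor {A : Torus κ → Set PhaseSpace}
    (hU : P.IsSolutionFamily U) (hP : P.Standing) (h2 : P.H2)
    (hA : IsGlobalAttractor (P.skewProduct U) (bundle A)) : P.IsPullbackAttractor U A := by
  have hemb : ∀ σ, Continuous fun φ : PhaseSpace => (WithLp.toLp 2 (φ, σ) : ExtendedSpace κ) :=
    fun σ => (WithLp.prod_continuous_toLp 2 _ _).comp (continuous_id.prodMk continuous_const)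
  have hfst : Continuous fun p : ExtendedSpace κ => p.fst := WithLp.continuous_fst 2 _ _
  refine ⟨fun σ => ?_, fun σ t ht => image_section_eq hA σ ht, fun σ B hB => ?_,
    fun C hC hatt σ => ?_⟩
  · have hclosed : IsClosed (A σ) := hA.isCompact.isClosed.preimage (hemb σ)
    refine (hA.isCompact.image hfst).of_isClosed_subset hclosed fun φ hφ => ?_
    exact ⟨WithLp.toLp 2 (φ, σ), hφ, rfl⟩
  · apply tendsto_semidist_of_subseq (Ψ := fun t => U t (P.θ (-t) σ))
    intro t x ht hx
    obtain ⟨R, hR⟩ := hB.exists_norm_le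
    -- Starting over `θ_{-t n} σ`, all lifted orbits end over the same `σ`. The moving starting
    -- symbols are harmless, as the cylinder contains every symbol.
    have hlift : ∀ n, (WithLp.toLp 2 (x n, P.θ (-t n) σ) : ExtendedSpace κ) ∈ cylinder κ R :=
      fun n => hR _ (hx n)
    obtain ⟨p, ns, hns, hp⟩ := hU.asymptoticallyCompactOn_skewProduct hP h2 R t _ ht hlift
    have hp' : Tendsto (fun n => (WithLp.toLp 2 (U (t (ns n)) (P.θ (-t (ns n)) σ) (x (ns n)), σ) :
        ExtendedSpace κ)) atTop (𝓝 p) := by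
      refine hp.congr fun n => ?_
      simp only [skewProduct, WithLp.toLp_fst, WithLp.toLp_snd, θ_θ_neg]
    have hsnd : p.snd = σ :=
      tendsto_nhds_unique (((WithLp.continuous_snd 2 _ _).tendsto p).comp hp') tendsto_const_nhds
    have hmem : p ∈ bundle A := by
      have h1 := (hA.attracts _ (isBounded_cylinder R)).comp (ht.comp hns.tendsto_atTop)
      have h3 : Tendsto (fun n => Metric.infEDist (P.skewProduct U (t (ns n))
          (WithLp.toLp 2 (x (ns n), P.θ (-t (ns n)) σ))) (bundle A)) atTop (𝓝 0) := by
        refine tendsto_of_tendsto_of_tendsto_of_le_of_le tendsto_const_nhds h1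
          (fun _ => zero_le) fun n => ?_
        exact le_iSup₂_of_le (f := fun y _ => Metric.infEDist y (bundle A)) _
          ⟨_, hlift (ns n), rfl⟩ le_rfl
      have h4 := tendsto_nhds_unique ((Metric.continuous_infEDist.tendsto p).comp hp) h3
      exact (Metric.mem_iff_infEDist_zero_of_closed hA.isCompact.isClosed).2 h4
    refine ⟨p.fst, ?_, ns, hns, (hfst.tendsto p).comp hp'⟩
    rw [← hsnd]
    exact hmem
  · obtain ⟨R, hR⟩ := exists_attractor_bound hA
    intro φ hφ
    -- Minimality: by invariance `A σ` lies in the image of one fixed ball for all `t ≥ 0`, and `C`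
    -- attracts this ball.
    have h0 := hatt σ (Metric.closedBall 0 R) Metric.isBounded_closedBall
    refine (Metric.mem_iff_infEDist_zero_of_closed (hC σ)).2 (le_antisymm ?_ zero_le)
    refine ge_of_tendsto h0 ?_
    filter_upwards [eventually_ge_atTop 0] with t ht
    have h1 : φ ∈ U t (P.θ (-t) σ) '' A (P.θ (-t) σ) := by
      rw [image_section_eq hA _ ht, θ_θ_neg]
      exact hφ
    obtain ⟨ψ, hψ, rfl⟩ := h1
    exact le_iSup₂_of_le (f := fun y _ => Metric.infEDist y (C σ)) _
      ⟨ψ, mem_closedBall_zero_iff.2 (hR _ _ hψ), rfl⟩ le_rfl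

/-- In every neighbourhood of the attractor there is a forward invariant family of sets that
uniformly attracts all bounded sets. -/
theorem exists_forward_attracting {A : Torus κ → Set PhaseSpace}
    (hU : P.IsSolutionFamily U) (hP : P.Standing) (h2 : P.H2)
    (hA : IsGlobalAttractor (P.skewProduct U) (bundle A)) {ε : ℝ} (hε : 0 < ε) :
    ∃ Aε : Torus κ → Set PhaseSpace,
      (∀ σ, A σ ⊆ Aε σ ∧ Aε σ ⊆ nbhdSection A ε σ) ∧
      (∀ σ t, 0 ≤ t → U t σ '' Aε σ ⊆ Aε (P.θ t σ)) ∧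
      ∀ B : Set PhaseSpace, Bornology.IsBounded B →
        Tendsto (fun t : ℝ => ⨆ σ, semidist (U t σ '' B) (Aε (P.θ t σ))) atTop (𝓝 0) := by
  obtain ⟨R₀, -, habs⟩ := hU.exists_absorbing hP h2
  obtain ⟨RA, hRA⟩ := exists_attractor_bound hA
  -- Large enough to absorb bounded sets, for the forward attraction, and to contain every section
  -- of the attractor, for `A σ ⊆ Aε σ`.
  set R := max R₀ RA with hR
  have hε' : (0 : ℝ≥0∞) < ENNReal.ofReal ε := ENNReal.ofReal_pos.2 hε
  obtain ⟨T, hT⟩ := (((hA.attracts _ (isBounded_cylinder R)).eventually_lt_const hε').and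
    (eventually_ge_atTop 0)).exists_forall_of_atTop
  have hT0 : 0 ≤ T := (hT T le_rfl).2
  refine ⟨fun σ => {φ | ∃ t, T ≤ t ∧ ∃ ψ, ‖ψ‖ ≤ R ∧ U t (P.θ (-t) σ) ψ = φ},
    fun σ => ⟨fun φ hφ => ?_, ?_⟩, fun σ t ht => ?_, fun B hB => ?_⟩
  · have h1 : φ ∈ U T (P.θ (-T) σ) '' A (P.θ (-T) σ) := by
      rw [image_section_eq hA _ hT0, θ_θ_neg]
      exact hφ
    obtain ⟨ψ, hψ, rfl⟩ := h1
    exact ⟨T, le_rfl, ψ, (hRA _ _ hψ).trans (le_max_right _ _), rfl⟩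
  · rintro _ ⟨t, ht, ψ, hψ, rfl⟩
    refine lt_of_le_of_lt ?_ (hT t ht).1
    refine le_iSup₂_of_le (f := fun y _ => Metric.infEDist y (bundle A)) _
      ⟨WithLp.toLp 2 (ψ, P.θ (-t) σ), hψ, rfl⟩ (le_of_eq ?_)
    simp only [skewProduct, WithLp.toLp_fst, WithLp.toLp_snd, θ_θ_neg]
  · rintro _ ⟨_, ⟨s, hs, ψ, hψ, rfl⟩, rfl⟩
    refine ⟨t + s, by linarith, ψ, hψ, ?_⟩
    rw [← θ_add, show -(t + s) + t = -s by ring, hU.add_apply ht (hT0.trans hs), θ_θ_neg]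
  · obtain ⟨RB, hRB⟩ := hB.exists_norm_le
    obtain ⟨TB, hTB, hTBabs⟩ := habs RB
    -- The supremum is exactly `0` from `T + TB` on: the orbit is in the ball of radius `R` at time
    -- `t - T`, and its last stretch of length `T` puts it in the family.
    refine tendsto_const_nhds.congr' ?_
    filter_upwards [eventually_ge_atTop (T + TB)] with t ht
    symm
    rw [ENNReal.iSup_eq_zero]
    intro σ
    rw [semidist, ENNReal.iSup_eq_zero]
    intro y
    rw [ENNReal.iSup_eq_zero]
    rintro ⟨x, hx, rfl⟩
    refine Metric.infEDist_zero_of_mem ⟨T, le_rfl, U (t - T) σ x, ?_, ?_⟩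
    · exact (hTBabs _ (by linarith) σ x (hRB x hx)).trans (le_max_left _ _)
    · rw [← θ_add, show -T + t = t - T by ring, ← hU.add_apply hT0 (by linarith),
        add_sub_cancel]

end IsSolutionFamily

end GrayScott

theorem theorem4p4 {κ : ℕ} (P : GrayScott κ) (hP : P.Standing) (h1 : P.H1) (h2 : P.H2) :
    ∃ U : ℝ → Torus κ → PhaseSpace → PhaseSpace, P.IsSolutionFamily U ∧
      ∃ A : Torus κ → Set PhaseSpace,
        P.IsPullbackAttractor U A ∧
        IsGlobalAttractor (P.skewProduct U) (bundle A) ∧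
        ∀ ε : ℝ, 0 < ε → ∃ Aε : Torus κ → Set PhaseSpace,
          (∀ σ, A σ ⊆ Aε σ ∧ Aε σ ⊆ nbhdSection A ε σ) ∧
          (∀ σ t, 0 ≤ t → U t σ '' Aε σ ⊆ Aε (P.θ t σ)) ∧
          ∀ B : Set PhaseSpace, Bornology.IsBounded B →
            Tendsto (fun t : ℝ => ⨆ σ, semidist (U t σ '' B) (Aε (P.θ t σ))) atTop (𝓝 0) := by
  obtain ⟨U, hU⟩ := GrayScott.exists_isSolutionFamily hP h2
  obtain ⟨A, hA⟩ := hU.exists_isGlobalAttractor hP h2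
  exact ⟨U, hU, A, hU.isPullbackAttractor hP h2 hA, hA,
    fun ε hε => hU.exists_forward_attracting hP h2 hA hε⟩
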